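/- Let $\mathcal H$ be a separable complex Hilbert space and $\mathfrak B(\mathcal H)$ the algebra of bounded operators on it. Let $G$ be a densely defined positive (semidefinite, self-adjoint) operator on $\mathcal H$ with $\inf\{\|G\varphi\| : \varphi\in\mathcal D(G),\ \|\varphi\|=1\}=0$, and let $E>0$. A linear operator $A:\mathcal D(\sqrt G)\to\mathcal H$ is called $\sqrt G$-bounded if $\|A\varphi\|^2\le a^2\|\varphi\|^2+b^2\|\sqrt G\varphi\|^2$ for all $\varphi\in\mathcal D(\sqrt G)$ and some $a,b\ge 0$; the infimum of all such $b$ is its $\sqrt G$-bound. Let $\mathfrak B^0_G(\mathcal H)$ be the linear space of all $\sqrt G$-bounded operators with $\sqrt G$-bound $0$; it contains $\mathfrak B(\mathcal H)$ (by restriction of bounded operators to $\mathcal D(\sqrt G)$). For $e\ge 0$ put $$\|A\|^G_e=\sup\{\|A\varphi\| : \varphi\in\mathcal D(\sqrt G),\ \|\varphi\|=1,\ \|\sqrt G\varphi\|^2\le e\}$$ (the supremum of the empty set being $0$). Let $\Phi:\mathfrak B(\mathcal H)\to\mathfrak B(\mathcal H)$ be a 2-positive linear map with $\Phi(I)\le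 I$ that has a predual map $\Phi_*$ on the trace class operators, i.e. $\operatorname{Tr}\Phi(A)\rho=\operatorname{Tr}A\Phi_*(\rho)$ for all bounded $A$ and trace class $\rho$, and suppose that $$Y_\Phi(E)=\sup\{\operatorname{Tr}G\Phi_*(\rho) : \rho\ge 0,\ \operatorname{Tr}\rho=1,\ \operatorname{Tr}G\rho\le E\}$$ is finite, where $\operatorname{Tr}G\rho=\sup_n\operatorname{Tr}P_nG\rho$ and $P_n$ is the spectral projector of $G$ corresponding to $[0,n]$. Then $\Phi$ has an extension to a linear operator $\Phi_G:\mathfrak B^0_G(\mathcal H)\to\mathfrak B^0_G(\mathcal H)$ that is bounded with respect to the norm $\|\cdot\|^G_E$; this extension is unique among such bounded linear operators, and for all $A\in\mathfrak B^0_G(\mathcal H)$ $$\|\Phi_G(A)\|^G_E\le\sqrt{\|\Phi(I)\|}\,\|A\|^G_{Y_\Phi(E)}\le\sqrt{\|\Phi(I)\|K_\Phi}\,\|A\|^G_E,\qquad K_\Phi=\max\{1,Y_\Phi(E)/E\}.$$ -/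

import Mathlib

open scoped InnerProductSpace ENNReal

namespace EnergyNorm

variable {H : Type*} [NormedAddCommGroup H] [InnerProductSpace ℂ H] [CompleteSpace H]

/-! ### Positive self-adjoint operators, their square roots and spectral projectors -/

/-- A positive (semidefinite) self-adjoint, possibly unbounded, operator.
Self-adjointness includes that the domain is dense. -/
structure IsPositiveOp (G : H →ₗ.[ℂ] H) : Prop where
  selfAdjoint : IsSelfAdjoint G
  nonneg : ∀ φ : G.domain, 0 ≤ (⟪(φ : H), G φ⟫_ℂ).re

/-- `R` is the bounded operator `(1 + G)⁻¹`: it maps `H` into `D(G)` and `(1 + G) R = 1`. -/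
def IsResolvent (G : H →ₗ.[ℂ] H) (R : H →L[ℂ] H) : Prop :=
  ∀ x : H, ∃ h : R x ∈ G.domain, R x + G ⟨R x, h⟩ = x

/-- The bounded operator `(1 + G)⁻¹`; for positive self-adjoint `G` exactly one operator
satisfies the defining property, and `0 ≤ (1 + G)⁻¹ ≤ 1`. -/
noncomputable def res (G : H →ₗ.[ℂ] H) : H →L[ℂ] H :=
  Classical.epsilon (IsResolvent G)

/-- The square root of a positive self-adjoint operator `G` by functional calculus: for
`R = (1 + G)⁻¹` one has `√G = √(1 - R) (√R)⁻¹`, since `√x = √(1 - r) / √r` for `r = 1 / (1 + x)`.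
The domain is the range of `√R`. -/
noncomputable def sqrtOp (G : H →ₗ.[ℂ] H) : H →ₗ.[ℂ] H :=
  (CFC.sqrt (1 - res G)).toLinearMap.compPMap
    ((CFC.sqrt (res G)).toLinearMap.toPMap ⊤).inverse

/-- The spectral projector `P_n` of `G` corresponding to the interval `[0, n]`. Since `x ≤ n`
means `1 / (1 + x) ≥ 1 / (1 + n)`, it is the spectral projector of `R = (1 + G)⁻¹` for
`[1 / (1 + n), ∞)`, i.e. the orthogonal projector onto the kernel of the positive part
of `1 / (1 + n) - R`. -/
noncomputable def specProj (G : H →ₗ.[ℂ] H) (n : ℕ) : H →L[ℂ] H :=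
  ((((1 / (1 + n : ℂ)) • (1 : H →L[ℂ] H) - res G)⁺).ker).starProjection

/-- `T` is the bounded operator `G P_n`, i.e. the bounded extension of `P_n G`. -/
def IsCutoff (G : H →ₗ.[ℂ] H) (n : ℕ) (T : H →L[ℂ] H) : Prop :=
  ∀ x : H, ∃ h : specProj G n x ∈ G.domain, T x = G ⟨specProj G n x, h⟩

/-- The bounded operator `P_n G` (extended by continuity from `D(G)` to `H`). -/
noncomputable def cutoff (G : H →ₗ.[ℂ] H) (n : ℕ) : H →L[ℂ] H :=
  Classical.epsilon (IsCutoff G n)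

/-- The condition `inf {‖G φ‖ | φ ∈ D(G), ‖φ‖ = 1} = 0`. -/
def InfZero (G : H →ₗ.[ℂ] H) : Prop :=
  IsGLB {r : ℝ | ∃ φ : G.domain, ‖(φ : H)‖ = 1 ∧ r = ‖G φ‖} 0

/-! ### Trace class operators and states -/

variable (H) in
/-- The index set of a fixed orthonormal basis of `H`. -/
noncomputable def basisIndex : Set H :=
  Classical.choose (exists_hilbertBasis ℂ H)

variable (H) in
/-- A fixed orthonormal basis of `H`, used to compute traces. -/
noncomputable def basis : HilbertBasis (basisIndex H) ℂ H :=
  Classical.choose (Classical.choose_spec (exists_hilbertBasis ℂ H))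

/-- `T` is trace class: `Tr |T| < ∞`. -/
def IsTraceClass (T : H →L[ℂ] H) : Prop :=
  Summable fun i => (⟪basis H i, CFC.abs T (basis H i)⟫_ℂ).re

variable (H) in
/-- The trace class operators on `H`. -/
def TraceClass : Type _ := {T : H →L[ℂ] H // IsTraceClass T}

/-- The trace of a trace class operator. -/
noncomputable def trace (T : H →L[ℂ] H) : ℂ :=
  ∑' i, ⟪basis H i, T (basis H i)⟫_ℂ

/-- States (density operators): positive trace class operators of trace one. -/
def IsState (ρ : TraceClass H) : Prop :=
  0 ≤ ρ.1 ∧ trace ρ.1 = 1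

/-- `Tr G ρ ∈ [0, ∞]`, defined as `sup_n Tr P_n G ρ`, for positive trace class `ρ`. -/
noncomputable def trG (G : H →ₗ.[ℂ] H) (ρ : TraceClass H) : ℝ≥0∞ :=
  ⨆ n : ℕ, ENNReal.ofReal (trace (cutoff G n * ρ.1)).re

/-! ### Maps on the algebra of bounded operators -/

/-- `Φ` is 2-positive: entrywise application of `Φ` preserves positivity of `2 × 2` matrices
over `B(H)`. -/
def IsTwoPositive (Φ : (H →L[ℂ] H) →ₗ[ℂ] (H →L[ℂ] H)) : Prop :=
  ∀ M : CStarMatrix (Fin 2) (Fin 2) (H →L[ℂ] H), 0 ≤ M → 0 ≤ M.map Φ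

/-- `Φs` is the predual map of `Φ`: `Tr Φ(A) ρ = Tr A Φs(ρ)` for all bounded `A` and trace
class `ρ`. This determines `Φs`, which is automatically linear and bounded. -/
def IsPredual (Φ : (H →L[ℂ] H) →ₗ[ℂ] (H →L[ℂ] H)) (Φs : TraceClass H → TraceClass H) : Prop :=
  ∀ (A : H →L[ℂ] H) (ρ : TraceClass H), trace (Φ A * ρ.1) = trace (A * (Φs ρ).1)

/-- `Y_Φ(E) = sup {Tr G Φs(ρ) | ρ a state, Tr G ρ ≤ E} ∈ [0, ∞]`. -/
noncomputable def Y (G : H →ₗ.[ℂ] H) (Φs : TraceClass H → TraceClass H) (E : ℝ) : ℝ≥0∞ :=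
  ⨆ (ρ : TraceClass H) (_ : IsState ρ) (_ : trG G ρ ≤ ENNReal.ofReal E), trG G (Φs ρ)

/-! ### Relatively bounded operators and the operator `E`-norms -/

/-- Linear operators defined on `D(√G)`. -/
abbrev SqrtDomOp (G : H →ₗ.[ℂ] H) : Type _ := (sqrtOp G).domain →ₗ[ℂ] H

/-- The set of all pairs `(a, b)` of nonnegative numbers with
`‖A φ‖² ≤ a² ‖φ‖² + b² ‖√G φ‖²` for all `φ ∈ D(√G)`. -/
def relBoundPairs (G : H →ₗ.[ℂ] H) (A : SqrtDomOp G) : Set (ℝ × ℝ) :=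
  {p | 0 ≤ p.1 ∧ 0 ≤ p.2 ∧ ∀ φ : (sqrtOp G).domain,
    ‖A φ‖ ^ 2 ≤ p.1 ^ 2 * ‖(φ : H)‖ ^ 2 + p.2 ^ 2 * ‖sqrtOp G φ‖ ^ 2}

/-- `A` is `√G`-bounded. -/
def IsRelBounded (G : H →ₗ.[ℂ] H) (A : SqrtDomOp G) : Prop :=
  (relBoundPairs G A).Nonempty

/-- The `√G`-bound of a `√G`-bounded operator `A`. -/
noncomputable def relBound (G : H →ₗ.[ℂ] H) (A : SqrtDomOp G) : ℝ :=
  sInf (Prod.snd '' relBoundPairs G A)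

/-- `A` is `√G`-infinitesimal: it is `√G`-bounded and its `√G`-bound is zero. -/
def IsInfinitesimal (G : H →ₗ.[ℂ] H) (A : SqrtDomOp G) : Prop :=
  IsRelBounded G A ∧ relBound G A = 0

theorem isInfinitesimal_iff {G : H →ₗ.[ℂ] H} {A : SqrtDomOp G} :
    IsInfinitesimal G A ↔ ∀ ε > 0, ∃ a b, (a, b) ∈ relBoundPairs G A ∧ b < ε := by
  have hbdd : BddBelow (Prod.snd '' relBoundPairs G A) := by
    refine ⟨0, ?_⟩
    rintro _ ⟨p, hp, rfl⟩
    exact hp.2.1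
  constructor
  · rintro ⟨hne, h0⟩ ε hε
    have hne' : (Prod.snd '' relBoundPairs G A).Nonempty := hne.image _
    obtain ⟨_, ⟨⟨a, b⟩, hp, rfl⟩, hlt⟩ :=
      exists_lt_of_csInf_lt hne' (lt_of_eq_of_lt h0 hε)
    exact ⟨a, b, hp, hlt⟩
  · intro h
    obtain ⟨a, b, hab, _⟩ := h 1 one_pos
    refine ⟨⟨_, hab⟩, le_antisymm ?_ ?_⟩
    · refine le_of_forall_pos_lt_add fun ε hε => ?_
      obtain ⟨a, b, hab, hb⟩ := h ε hε
      rw [zero_add]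
      exact (csInf_le hbdd ⟨_, hab, rfl⟩).trans_lt hb
    · refine le_csInf ⟨b, _, hab, rfl⟩ ?_
      rintro _ ⟨p, hp, rfl⟩
      exact hp.2.1

/-- The space `B⁰_G(H)` of all `√G`-infinitesimal operators. -/
noncomputable def InfOp (G : H →ₗ.[ℂ] H) : Submodule ℂ (SqrtDomOp G) where
  carrier := {A | IsInfinitesimal G A}
  zero_mem' := isInfinitesimal_iff.2 fun ε hε =>
    ⟨0, 0, ⟨le_rfl, le_rfl, fun φ => by simp⟩, hε⟩
  add_mem' := by
    intro A B hA hB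
    refine isInfinitesimal_iff.2 fun ε hε => ?_
    obtain ⟨a, b, ⟨ha, hb, h⟩, hbε⟩ := isInfinitesimal_iff.1 hA (ε / 4) (by positivity)
    obtain ⟨c, d, ⟨hc, hd, h'⟩, hdε⟩ := isInfinitesimal_iff.1 hB (ε / 4) (by positivity)
    simp only at ha hb h hc hd h'
    refine ⟨2 * (a + c), 2 * (b + d), ⟨by positivity, by positivity, fun φ => ?_⟩, by linarith⟩
    have h1 : ‖(A + B) φ‖ ^ 2 ≤ 2 * ‖A φ‖ ^ 2 + 2 * ‖B φ‖ ^ 2 := by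
      have h2 : ‖(A + B) φ‖ ≤ ‖A φ‖ + ‖B φ‖ := norm_add_le _ _
      nlinarith [sq_nonneg (‖A φ‖ - ‖B φ‖), norm_nonneg ((A + B) φ)]
    have h3 : 2 * (a ^ 2 + c ^ 2) ≤ (2 * (a + c)) ^ 2 := by nlinarith [mul_nonneg ha hc]
    have h4 : 2 * (b ^ 2 + d ^ 2) ≤ (2 * (b + d)) ^ 2 := by nlinarith [mul_nonneg hb hd]
    have h5 := mul_le_mul_of_nonneg_right h3 (sq_nonneg ‖(φ : H)‖)
    have h6 := mul_le_mul_of_nonneg_right h4 (sq_nonneg ‖sqrtOp G φ‖)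
    have h7 := h φ
    have h8 := h' φ
    show ‖(A + B) φ‖ ^ 2 ≤
      (2 * (a + c)) ^ 2 * ‖(φ : H)‖ ^ 2 + (2 * (b + d)) ^ 2 * ‖sqrtOp G φ‖ ^ 2
    linarith
  smul_mem' := by
    intro z A hA
    refine isInfinitesimal_iff.2 fun ε hε => ?_
    obtain ⟨a, b, ⟨ha, hb, h⟩, hbε⟩ :=
      isInfinitesimal_iff.1 hA (ε / (‖z‖ + 1)) (by positivity)
    simp only at ha hb h
    refine ⟨‖z‖ * a, ‖z‖ * b, ⟨by positivity, by positivity, fun φ => ?_⟩, ?_⟩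
    · have h1 := mul_le_mul_of_nonneg_left (h φ) (sq_nonneg ‖z‖)
      show ‖z • A φ‖ ^ 2 ≤
        (‖z‖ * a) ^ 2 * ‖(φ : H)‖ ^ 2 + (‖z‖ * b) ^ 2 * ‖sqrtOp G φ‖ ^ 2
      rw [norm_smul]
      linarith
    · rw [lt_div_iff₀ (by positivity)] at hbε
      linarith

/-- A bounded operator, restricted to `D(√G)`, as an element of `B⁰_G(H)`. -/
noncomputable def ofBounded (G : H →ₗ.[ℂ] H) (A : H →L[ℂ] H) : InfOp G :=
  ⟨A.toLinearMap.domRestrict (sqrtOp G).domain, isInfinitesimal_iff.2 fun ε hε =>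
    ⟨‖A‖, 0, ⟨norm_nonneg _, le_rfl, fun φ => by
      have h := pow_le_pow_left₀ (norm_nonneg _) (A.le_opNorm (φ : H)) 2
      simpa [mul_pow] using h⟩, hε⟩⟩

/-- The operator `E`-norm `‖A‖^G_E = sup {‖A φ‖ | ‖φ‖ = 1, ⟨φ|G|φ⟩ = ‖√G φ‖² ≤ E}`. -/
noncomputable def eNorm (G : H →ₗ.[ℂ] H) (E : ℝ) (A : SqrtDomOp G) : ℝ≥0∞ :=
  ⨆ (φ : (sqrtOp G).domain) (_ : ‖(φ : H)‖ = 1) (_ : ‖sqrtOp G φ‖ ^ 2 ≤ E), ‖A φ‖ₑ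

/-- A linear operator on `B⁰_G(H)` is bounded with respect to the operator `E`-norm. -/
def IsBoundedOp (G : H →ₗ.[ℂ] H) (E : ℝ) (Ψ : InfOp G →ₗ[ℂ] InfOp G) : Prop :=
  ∃ C : NNReal, ∀ A : InfOp G, eNorm G E (Ψ A) ≤ C * eNorm G E A

/-- `Ψ` extends `Φ` from the bounded operators to `B⁰_G(H)`. -/
def Extends (G : H →ₗ.[ℂ] H) (Φ : (H →L[ℂ] H) →ₗ[ℂ] (H →L[ℂ] H))
    (Ψ : InfOp G →ₗ[ℂ] InfOp G) : Prop :=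
  ∀ A : H →L[ℂ] H, Ψ (ofBounded G A) = ofBounded G (Φ A)

end EnergyNorm

/-! The extension is `Φ_G(A) φ = lim Φ(A P_n) φ` for `φ ∈ D(√G)`. Three facts make it work.

Kadison's inequality `‖Φ(B) φ‖² ≤ ‖Φ(1)‖ ⟨φ, Φ(B*B) φ⟩` (`norm_map_apply_sq_le`) turns a form bound
`B*B ≤ α + κ G P_n` into a bound on `Φ(B) φ`. There `⟨φ, Φ(G P_n) φ⟩ = Tr G P_n Φ_*(|φ⟩⟨φ|)` is at
most `Y = Y_Φ(E)` for unit `φ` of energy at most `E`.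

The S-lemma (`exists_dominating_form`) supplies such form bounds without loss: for `e > 0` there are
`α, κ ≥ 0` with `A*A ≤ α + κ G` as forms and `α + κ e = (‖A‖_e)²`. Taking `e = Y` yields `‖Φ(A P_n)
φ‖² ≤ ‖Φ(1)‖ (α + κ Y) = ‖Φ(1)‖ (‖A‖_Y)²`, the first inequality. Taking `e = E`, the estimate `α + κ
Y ≤ max(1, Y/E) (α + κ E)` is the second.

Relative bound zero gives `‖(A - A P_m) φ‖² ≤ δ ‖√G φ‖²` for all large `m` (`norm_sub_trunc_sq_le`).
With Kadison's inequality this makes `Φ(A P_n) φ` Cauchy. It also makes the bounded operators dense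
in the `E`-norm, whence uniqueness. That `Φ_G` extends `Φ` is normality, which the predual map
provides. -/

namespace EnergyNorm

/-! ### Quadratic forms of bounded operators, and the resolvent of `G`. -/

variable {H : Type*} [NormedAddCommGroup H] [InnerProductSpace ℂ H]

theorem re_inner_nonneg {T : H →L[ℂ] H} (hT : 0 ≤ T) (x : H) : 0 ≤ (⟪x, T x⟫_ℂ).re :=
  ((ContinuousLinearMap.nonneg_iff_isPositive T).1 hT).re_inner_nonneg_right x

variable [CompleteSpace H]

theorem re_inner_mono {S T : H →L[ℂ] H} (h : S ≤ T) (x : H) :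
    (⟪x, S x⟫_ℂ).re ≤ (⟪x, T x⟫_ℂ).re := by
  have := re_inner_nonneg (sub_nonneg.2 h) x
  simpa [inner_sub_right] using this

theorem le_of_re_inner {S T : H →L[ℂ] H} (hS : IsSelfAdjoint S) (hT : IsSelfAdjoint T)
    (h : ∀ x, (⟪x, S x⟫_ℂ).re ≤ (⟪x, T x⟫_ℂ).re) : S ≤ T := by
  rw [ContinuousLinearMap.le_def, ContinuousLinearMap.isPositive_def]
  refine ⟨(hT.sub hS).isSymmetric, fun x => ?_⟩
  rw [ContinuousLinearMap.reApplyInnerSelf_apply, ← inner_re_symm]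
  have := h x
  simpa [inner_sub_right] using this

theorem IsSelfAdjoint.inner_map {T : H →L[ℂ] H} (hT : IsSelfAdjoint T) (x y : H) :
    ⟪T x, y⟫_ℂ = ⟪x, T y⟫_ℂ :=
  hT.isSymmetric x y

theorem norm_sqrt_apply_sq {T : H →L[ℂ] H} (hT : 0 ≤ T) (x : H) :
    ‖CFC.sqrt T x‖ ^ 2 = (⟪x, T x⟫_ℂ).re := by
  have h1 := CFC.sqrt_mul_sqrt_self T hT
  have h2 : IsSelfAdjoint (CFC.sqrt T) := (CFC.sqrt_nonneg T).isSelfAdjoint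
  rw [← h1, mul_apply_eq_comp, ← IsSelfAdjoint.inner_map h2, h1]
  exact (inner_self_eq_norm_sq (𝕜 := ℂ) _).symm

namespace IsPositiveOp

variable {G : H →ₗ.[ℂ] H}

theorem inner_map (hG : IsPositiveOp G) (x y : G.domain) :
    ⟪G x, (y : H)⟫_ℂ = ⟪(x : H), G y⟫_ℂ := by
  have h := LinearPMap.adjoint_isFormalAdjoint (T := G) hG.selfAdjoint.dense_domain
  rw [LinearPMap.isSelfAdjoint_def.1 hG.selfAdjoint] at h
  exact h x y

theorem norm_le_norm_add (hG : IsPositiveOp G) (x : G.domain) : ‖(x : H)‖ ≤ ‖(x : H) + G x‖ := by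
  have h1 : ‖(x : H)‖ * ‖(x : H)‖ ≤ (⟪(x : H), (x : H) + G x⟫_ℂ).re := by
    rw [inner_add_right, Complex.add_re]
    have h2 := hG.nonneg x
    have h3 : (⟪(x : H), (x : H)⟫_ℂ).re = ‖(x : H)‖ * ‖(x : H)‖ :=
      inner_self_eq_norm_mul_norm (𝕜 := ℂ) _
    linarith
  have h4 := h1.trans (re_inner_le_norm (𝕜 := ℂ) (x : H) ((x : H) + G x))
  by_contra h
  have h5 : 0 < ‖(x : H)‖ := (norm_nonneg _).trans_lt (not_le.1 h)
  exact h (le_of_mul_le_mul_left h4 h5)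

/-- The range of `1 + G` is closed because `‖x‖ ≤ ‖(1 + G) x‖` and `G` is closed. It is dense
because a vector `z` orthogonal to it satisfies `G* z = -z`, so `z ∈ D(G)` with `(1 + G) z = 0`, and
the same inequality gives `z = 0`. -/
theorem range_one_add (hG : IsPositiveOp G) (y : H) : ∃ x : G.domain, (x : H) + G x = y := by
  let T : G.domain →ₗ[ℂ] H := G.domain.subtype + G.toFun
  have hT : ∀ x, T x = (x : H) + G x := fun x => rfl
  have hcl : IsClosed (T.range : Set H) := by
    refine IsSeqClosed.isClosed fun u y hu hy => ?_
    choose x hx using hu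
    have hc : CauchySeq fun n => (x n : H) := by
      refine Metric.cauchySeq_iff'.2 fun ε hε => ?_
      obtain ⟨N, hN⟩ := Metric.cauchySeq_iff'.1 hy.cauchySeq ε hε
      refine ⟨N, fun n hn => ?_⟩
      refine lt_of_le_of_lt ?_ (hN n hn)
      rw [dist_eq_norm, dist_eq_norm, ← hx, ← hx, ← map_sub]
      simpa [hT] using hG.norm_le_norm_add (x n - x N)
    obtain ⟨z, hz⟩ := cauchySeq_tendsto_of_complete hc
    have hGz : Filter.Tendsto (fun n => G (x n)) Filter.atTop (nhds (y - z)) := by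
      have := hy.sub hz
      refine this.congr fun n => ?_
      rw [← hx, hT, add_sub_cancel_left]
    have hg : (z, y - z) ∈ G.graph := by
      refine hG.selfAdjoint.isClosed.mem_of_tendsto (hz.prodMk_nhds hGz) ?_
      exact Filter.Eventually.of_forall fun n => G.mem_graph (x n)
    obtain ⟨w, hw1, hw2⟩ := (LinearPMap.mem_graph_iff G).1 hg
    refine ⟨w, ?_⟩
    simp only at hw1 hw2
    rw [hT, hw2, hw1, add_sub_cancel]
  have htop : T.range = ⊤ := by
    have : CompleteSpace T.range := hcl.completeSpace_coe
    rw [← Submodule.orthogonal_eq_bot_iff, Submodule.eq_bot_iff]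
    intro z hz
    rw [Submodule.mem_orthogonal'] at hz
    have h0 : ∀ x : G.domain, ⟪-z, (x : H)⟫_ℂ = ⟪z, G x⟫_ℂ := fun x => by
      have := hz (T x) ⟨x, rfl⟩
      rw [hT, inner_add_right] at this
      rw [inner_neg_left]
      exact neg_eq_of_add_eq_zero_right this
    have hz' := LinearPMap.mem_adjoint_domain_of_exists (T := G) z ⟨-z, h0⟩
    have happ := LinearPMap.adjoint_apply_eq hG.selfAdjoint.dense_domain ⟨z, hz'⟩ h0
    have hgr : (z, -z) ∈ (G.adjoint).graph := by
      have := (G.adjoint).mem_graph ⟨z, hz'⟩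
      rwa [happ] at this
    rw [LinearPMap.isSelfAdjoint_def.1 hG.selfAdjoint] at hgr
    obtain ⟨w, hw1, hw2⟩ := (LinearPMap.mem_graph_iff G).1 hgr
    simp only at hw1 hw2
    have h1 := hG.nonneg w
    have h2 := hG.norm_le_norm_add w
    rw [hw2, hw1, add_neg_cancel, norm_zero] at h2
    exact norm_le_zero_iff.1 h2
  have : y ∈ T.range := htop ▸ Submodule.mem_top
  exact this

theorem isResolvent_res (hG : IsPositiveOp G) : IsResolvent G (res G) := by
  refine Classical.epsilon_spec (p := IsResolvent G) ?_
  let T : G.domain →ₗ[ℂ] H := G.domain.subtype + G.toFun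
  have hT : ∀ x, T x = (x : H) + G x := fun x => rfl
  have hinj : Function.Injective T := by
    refine (injective_iff_map_eq_zero T).2 fun x hx => ?_
    have := hG.norm_le_norm_add x
    rw [← hT, hx, norm_zero] at this
    exact Subtype.ext (norm_le_zero_iff.1 this)
  let e := LinearEquiv.ofBijective T ⟨hinj, hG.range_one_add⟩
  have he : ∀ y, T (e.symm y) = y := fun y => e.apply_symm_apply y
  refine ⟨(G.domain.subtype ∘ₗ e.symm.toLinearMap).mkContinuous 1 fun y => ?_, fun y => ?_⟩
  · have := hG.norm_le_norm_add (e.symm y)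
    rw [← hT, he] at this
    simpa using this
  · exact ⟨(e.symm y).2, he y⟩

theorem res_mem (hG : IsPositiveOp G) (x : H) : res G x ∈ G.domain :=
  (hG.isResolvent_res x).1

theorem apply_res (hG : IsPositiveOp G) (x : H) (h : res G x ∈ G.domain) :
    G ⟨res G x, h⟩ = (1 - res G) x := by
  obtain ⟨_, h'⟩ := hG.isResolvent_res x
  rw [sub_apply]
  exact eq_sub_of_add_eq' h'

theorem res_apply_add (hG : IsPositiveOp G) (x : G.domain) : res G (x + G x) = x := by
  obtain ⟨h, h'⟩ := hG.isResolvent_res (x + G x)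
  have := hG.norm_le_norm_add (⟨_, h⟩ - x)
  rw [LinearPMap.map_sub, AddSubgroupClass.coe_sub, sub_add_sub_comm, h', sub_self,
    norm_zero] at this
  exact sub_eq_zero.1 (norm_le_zero_iff.1 this)

theorem res_isSelfAdjoint (hG : IsPositiveOp G) : IsSelfAdjoint (res G) := by
  rw [ContinuousLinearMap.isSelfAdjoint_iff_isSymmetric]
  intro x y
  obtain ⟨hx, hx'⟩ := hG.isResolvent_res x
  obtain ⟨hy, hy'⟩ := hG.isResolvent_res y
  change ⟪res G x, y⟫_ℂ = ⟪x, res G y⟫_ℂ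
  conv_lhs => rw [← hy', inner_add_right]
  conv_rhs => rw [← hx', inner_add_left]
  rw [hG.inner_map ⟨_, hx⟩ ⟨_, hy⟩]

theorem res_nonneg (hG : IsPositiveOp G) : 0 ≤ res G := by
  refine le_of_re_inner (IsSelfAdjoint.zero _) hG.res_isSelfAdjoint fun x => ?_
  obtain ⟨hx, hx'⟩ := hG.isResolvent_res x
  rw [← IsSelfAdjoint.inner_map hG.res_isSelfAdjoint]
  conv_rhs => rw [← hx', inner_add_right]
  have h1 := hG.nonneg ⟨_, hx⟩
  have h2 : 0 ≤ (⟪res G x, res G x⟫_ℂ).re := inner_self_nonneg (𝕜 := ℂ)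
  simp only [zero_apply, inner_zero_right, Complex.zero_re, Complex.add_re,
    hx'] at *
  linarith

theorem res_le_one (hG : IsPositiveOp G) : res G ≤ 1 := by
  refine le_of_re_inner hG.res_isSelfAdjoint (IsSelfAdjoint.one _) fun x => ?_
  obtain ⟨hx, hx'⟩ := hG.isResolvent_res x
  have h1 := hG.nonneg ⟨_, hx⟩
  have h2 : 0 ≤ (⟪G ⟨_, hx⟩, G ⟨_, hx⟩⟫_ℂ).re := inner_self_nonneg (𝕜 := ℂ)
  have h3 : (⟪x, G ⟨_, hx⟩⟫_ℂ).re =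
      (⟪res G x, G ⟨_, hx⟩⟫_ℂ).re + (⟪G ⟨_, hx⟩, G ⟨_, hx⟩⟫_ℂ).re := by
    rw [← Complex.add_re, ← inner_add_left, hx']
  have h4 : (⟪x, x⟫_ℂ).re = (⟪x, res G x⟫_ℂ).re + (⟪x, G ⟨_, hx⟩⟫_ℂ).re := by
    rw [← Complex.add_re, ← inner_add_right, hx']
  rw [one_apply_eq_self]
  simp only at h1
  linarith

theorem one_sub_res_nonneg (hG : IsPositiveOp G) : 0 ≤ 1 - res G :=
  sub_nonneg.2 hG.res_le_one

theorem eq_zero_of_res_apply (hG : IsPositiveOp G) {x : H} (hx : res G x = 0) : x = 0 := by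
  obtain ⟨h, h'⟩ := hG.isResolvent_res x
  rw [show (⟨res G x, h⟩ : G.domain) = 0 from Subtype.ext hx, LinearPMap.map_zero, hx,
    add_zero] at h'
  exact h'.symm

end IsPositiveOp

end EnergyNorm

/-! ### The square root, the spectral projectors and the cutoffs of `G`. -/

namespace EnergyNorm

variable {H : Type*} [NormedAddCommGroup H] [InnerProductSpace ℂ H] [CompleteSpace H]

theorem mem_domain_sqrtOp_iff (G : H →ₗ.[ℂ] H) (φ : H) :
    φ ∈ (sqrtOp G).domain ↔ ∃ x, CFC.sqrt (res G) x = φ := by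
  change φ ∈ (LinearPMap.inverse _).domain ↔ _
  rw [LinearPMap.inverse_domain]
  constructor
  · rintro ⟨x, hx⟩
    exact ⟨x, hx⟩
  · rintro ⟨x, hx⟩
    exact ⟨⟨x, trivial⟩, hx⟩

/-- `S` leaves the kernel of `K` invariant; as `S` is self-adjoint, taking adjoints shows that it
also leaves the orthogonal complement invariant. -/
theorem commute_starProjection_ker {K S : H →L[ℂ] H} (hS : IsSelfAdjoint S)
    (h : Commute S K) : Commute S K.ker.starProjection := by
  have h1 : K.ker.starProjection * (S * K.ker.starProjection) = S * K.ker.starProjection := by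
    ext x
    refine Submodule.starProjection_eq_self_iff.2 ?_
    rw [LinearMap.mem_ker]
    have h2 : K.ker.starProjection x ∈ K.ker := Submodule.starProjection_apply_mem _ _
    have h3 : K (K.ker.starProjection x) = 0 := h2
    have h4 := congrArg (fun T : H →L[ℂ] H => T (K.ker.starProjection x)) h.eq
    change S (K (K.ker.starProjection x)) = K (S (K.ker.starProjection x)) at h4
    rw [h3, map_zero] at h4
    exact h4.symm
  have h2 : IsSelfAdjoint K.ker.starProjection := isSelfAdjoint_starProjection _
  have h3 := congrArg star h1
  rw [star_mul, star_mul, hS.star_eq, h2.star_eq, mul_assoc, h1] at h3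
  exact h3

theorem commute_specProj {G : H →ₗ.[ℂ] H} {S : H →L[ℂ] H} (hS : IsSelfAdjoint S)
    (hR : IsSelfAdjoint (res G)) (h : Commute S (res G)) (n : ℕ) : Commute S (specProj G n) := by
  refine commute_starProjection_ker hS ?_
  refine (IsSelfAdjoint.commute_cfcₙ ?_ ?_ _).symm
  · refine IsSelfAdjoint.sub ?_ hR
    refine IsSelfAdjoint.smul ?_ (IsSelfAdjoint.one _)
    rw [isSelfAdjoint_iff]
    simp
  · exact (Commute.sub_right ((Commute.one_right S).smul_right _) h).symm

theorem specProj_isSelfAdjoint (G : H →ₗ.[ℂ] H) (n : ℕ) : IsSelfAdjoint (specProj G n) :=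
  isSelfAdjoint_starProjection _

theorem specProj_mul_self (G : H →ₗ.[ℂ] H) (n : ℕ) :
    specProj G n * specProj G n = specProj G n :=
  Submodule.isIdempotentElem_starProjection _

theorem norm_specProj_apply_le (G : H →ₗ.[ℂ] H) (n : ℕ) (x : H) : ‖specProj G n x‖ ≤ ‖x‖ :=
  Submodule.norm_starProjection_apply_le _ _

theorem norm_one_sub_specProj_apply_le (G : H →ₗ.[ℂ] H) (n : ℕ) (x : H) :
    ‖(1 - specProj G n) x‖ ≤ ‖x‖ := by
  change ‖x - Submodule.starProjection _ x‖ ≤ _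
  rw [← Submodule.starProjection_orthogonal_val]
  exact Submodule.norm_starProjection_apply_le _ _

namespace IsPositiveOp

variable {G : H →ₗ.[ℂ] H}

theorem sqrt_injective (hG : IsPositiveOp G) {x : H} (hx : CFC.sqrt (res G) x = 0) : x = 0 := by
  refine hG.eq_zero_of_res_apply ?_
  have h := CFC.sqrt_mul_sqrt_self (res G) hG.res_nonneg
  rw [← h]
  change CFC.sqrt (res G) (CFC.sqrt (res G) x) = 0
  rw [hx, map_zero]

theorem sqrtOp_apply (hG : IsPositiveOp G) (φ : (sqrtOp G).domain) {x : H}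
    (h : CFC.sqrt (res G) x = φ) : sqrtOp G φ = CFC.sqrt (1 - res G) x := by
  have hker : ((CFC.sqrt (res G)).toLinearMap.toPMap ⊤).toFun.ker = ⊥ := by
    rw [LinearMap.ker_eq_bot']
    rintro ⟨y, hy⟩ h0
    exact Subtype.ext (hG.sqrt_injective h0)
  have := LinearPMap.inverse_apply_eq hker (y := φ) (x := ⟨x, trivial⟩) h
  change CFC.sqrt (1 - res G) (LinearPMap.inverse _ φ) = _
  rw [this]

theorem commute_sqrt_res (hG : IsPositiveOp G) : Commute (CFC.sqrt (res G)) (res G) := by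
  have h := CFC.sqrt_mul_sqrt_self (res G) hG.res_nonneg
  have h2 : Commute (CFC.sqrt (res G)) (CFC.sqrt (res G) * CFC.sqrt (res G)) :=
    (Commute.refl _).mul_right (Commute.refl _)
  rwa [h] at h2

theorem commute_sqrt_one_sub_res (hG : IsPositiveOp G) :
    Commute (CFC.sqrt (1 - res G)) (res G) := by
  have h := CFC.sqrt_mul_sqrt_self (1 - res G) hG.one_sub_res_nonneg
  have h2 : Commute (CFC.sqrt (1 - res G)) (CFC.sqrt (1 - res G) * CFC.sqrt (1 - res G)) :=
    (Commute.refl _).mul_right (Commute.refl _)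
  rw [h] at h2
  simpa using (Commute.one_right (CFC.sqrt (1 - res G))).sub_right h2

theorem commute_sqrt_sqrt (hG : IsPositiveOp G) :
    Commute (CFC.sqrt (res G)) (CFC.sqrt (1 - res G)) :=
  (Commute.cfcₙ_nnreal ((Commute.one_left _).sub_left hG.commute_sqrt_res.symm) _).symm

/-- On the spectral subspace of `[0, n]` the resolvent has a bounded inverse. -/
theorem exists_inverse_on_specProj (hG : IsPositiveOp G) (n : ℕ) :
    ∃ V : H →L[ℂ] H, IsSelfAdjoint V ∧
      (∀ S, IsSelfAdjoint S → Commute S (res G) → Commute S V) ∧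
      res G * V * specProj G n = specProj G n := by
  set c : ℂ := 1 / (1 + n : ℂ) with hc
  have hc' : c = ((1 / (1 + n) : ℝ) : ℂ) := by rw [hc]; push_cast; rfl
  have hcpos : (0 : ℝ) < 1 / (1 + n) := by positivity
  set L : H →L[ℂ] H := c • (1 : H →L[ℂ] H) - res G with hL
  have hc1 : IsSelfAdjoint (c • (1 : H →L[ℂ] H)) := by
    refine IsSelfAdjoint.smul ?_ (IsSelfAdjoint.one _)
    rw [isSelfAdjoint_iff, hc']
    simp
  have hLs : IsSelfAdjoint L := hc1.sub hG.res_isSelfAdjoint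
  -- `Z` is `max(R, c)`: it is bounded below by `c`, hence invertible, and `R = Z - L⁺` agrees with
  -- it on the kernel of `L⁺`, the range of `P_n`. The inverse sought is `Z⁻¹`.
  set Z : H →L[ℂ] H := c • (1 : H →L[ℂ] H) + L⁻ with hZ
  have hN : 0 ≤ L⁻ := CFC.negPart_nonneg L
  have hZu : IsUnit Z := by
    refine ContinuousLinearMap.isUnit_of_forall_le_norm_inner_map Z
      (c := ⟨1 / (1 + n), hcpos.le⟩) hcpos fun x => ?_
    refine le_trans ?_ (Complex.re_le_norm _)
    have h1 := re_inner_nonneg hN x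
    rw [IsSelfAdjoint.inner_map (hc1.add hN.isSelfAdjoint)]
    have h2 : (⟪x, (c • (1 : H →L[ℂ] H) + L⁻) x⟫_ℂ).re =
        (1 / (1 + n) : ℝ) * ‖x‖ ^ 2 + (⟪x, L⁻ x⟫_ℂ).re := by
      change (⟪x, c • x + L⁻ x⟫_ℂ).re = _
      rw [inner_add_right, inner_smul_right, hc', inner_self_eq_norm_sq_to_K, Complex.add_re,
        Complex.re_ofReal_mul]
      norm_cast
    rw [h2]
    change ‖x‖ ^ 2 * (1 / (1 + n) : ℝ) ≤ _
    linarith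
  have hZs : IsSelfAdjoint Z := hc1.add hN.isSelfAdjoint
  obtain ⟨u, hu⟩ := hZu
  have hcomm : ∀ S, IsSelfAdjoint S → Commute S (res G) → Commute S Z := fun S _ hSR => by
    refine Commute.add_right ((Commute.one_right S).smul_right _) ?_
    exact (IsSelfAdjoint.commute_cfcₙ hLs
      (Commute.sub_right ((Commute.one_right S).smul_right _) hSR).symm _).symm
  have hVc : ∀ S, IsSelfAdjoint S → Commute S (res G) → Commute S (↑u⁻¹ : H →L[ℂ] H) :=
    fun S hS hSR => Commute.units_inv_right (by rw [hu]; exact hcomm S hS hSR)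
  refine ⟨(↑u⁻¹ : H →L[ℂ] H), ?_, hVc, ?_⟩
  · have : IsSelfAdjoint u := Units.ext (by rw [Units.coe_star, hu]; exact hZs)
    have h2 := congrArg Units.val this.inv.star_eq
    exact h2
  · have hKP : L⁺ * specProj G n = 0 := by
      ext x
      exact (Submodule.starProjection_apply_mem (L⁺).ker x : _ ∈ (L⁺).ker)
    have hRZ : res G = Z - L⁺ := by
      have := CFC.posPart_sub_negPart L hLs
      rw [hZ]
      have h2 : res G = c • (1 : H →L[ℂ] H) - L := by rw [hL]; abel
      rw [h2]
      nth_rw 1 [← this]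
      abel
    have h3 := hVc _ hG.res_isSelfAdjoint (Commute.refl _)
    rw [h3.eq, mul_assoc]
    have h4 : res G * specProj G n = Z * specProj G n := by
      nth_rw 1 [hRZ]
      rw [sub_mul, hKP, sub_zero]
    rw [h4, ← hu, Units.inv_mul_cancel_left]

/-- On the spectral subspace of `(n, ∞)` the resolvent is at most `1 / (1 + n)`. -/
theorem re_inner_res_one_sub_specProj_le (hG : IsPositiveOp G) (n : ℕ) (x : H) :
    (1 + n) * (⟪(1 - specProj G n) x, res G ((1 - specProj G n) x)⟫_ℂ).re ≤
      ‖(1 - specProj G n) x‖ ^ 2 := by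
  set c : ℂ := 1 / (1 + n : ℂ) with hc
  have hc' : c = ((1 / (1 + n) : ℝ) : ℂ) := by rw [hc]; push_cast; rfl
  set L : H →L[ℂ] H := c • (1 : H →L[ℂ] H) - res G with hL
  have hc1 : IsSelfAdjoint (c • (1 : H →L[ℂ] H)) := by
    refine IsSelfAdjoint.smul ?_ (IsSelfAdjoint.one _)
    rw [isSelfAdjoint_iff, hc']
    simp
  have hLs : IsSelfAdjoint L := hc1.sub hG.res_isSelfAdjoint
  set y := (1 - specProj G n) x with hy
  have hyo : y ∈ (L⁺).kerᗮ := by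
    rw [hy]
    exact Submodule.sub_starProjection_mem_orthogonal (K := (L⁺).ker) x
  -- The range of `L⁻` lies in the kernel of `L⁺`, to which `y` is orthogonal.
  have hNy : L⁻ y = 0 := by
    refine ext_inner_right ℂ fun z => ?_
    rw [IsSelfAdjoint.inner_map (CFC.negPart_nonneg L).isSelfAdjoint, inner_zero_left]
    refine (Submodule.mem_orthogonal' _ _).1 hyo _ ?_
    have := congrArg (fun T : H →L[ℂ] H => T z) (CFC.posPart_mul_negPart L)
    exact this
  have hLy : L y = L⁺ y := by
    have := congrArg (fun T : H →L[ℂ] H => T y) (CFC.posPart_sub_negPart L hLs)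
    change L⁺ y - L⁻ y = L y at this
    rw [← this, hNy, sub_zero]
  have h1 := re_inner_nonneg (CFC.posPart_nonneg L) y
  rw [← hLy] at h1
  change 0 ≤ (⟪y, c • y - res G y⟫_ℂ).re at h1
  rw [inner_sub_right, inner_smul_right, hc', inner_self_eq_norm_sq_to_K, Complex.sub_re,
    Complex.re_ofReal_mul] at h1
  have h2 : (((‖y‖ : ℂ)) ^ 2).re = ‖y‖ ^ 2 := by norm_cast
  have h3 : (0 : ℝ) < 1 + n := by positivity
  have h4 : (⟪y, res G y⟫_ℂ).re ≤ 1 / (1 + n) * ‖y‖ ^ 2 := by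
    have : (((‖y‖ : ℂ)) ^ 2).re = ‖y‖ ^ 2 := by norm_cast
    simp only [Complex.coe_algebraMap] at h1
    rw [this] at h1
    linarith
  calc _ ≤ (1 + n) * (1 / (1 + n) * ‖y‖ ^ 2) := mul_le_mul_of_nonneg_left h4 h3.le
    _ = ‖y‖ ^ 2 := by field_simp

theorem commute_sqrt_specProj (hG : IsPositiveOp G) (n : ℕ) :
    Commute (CFC.sqrt (res G)) (specProj G n) :=
  commute_specProj (CFC.sqrt_nonneg _).isSelfAdjoint hG.res_isSelfAdjoint hG.commute_sqrt_res n

theorem commute_sqrt_one_sub_specProj (hG : IsPositiveOp G) (n : ℕ) :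
    Commute (CFC.sqrt (1 - res G)) (specProj G n) :=
  commute_specProj (CFC.sqrt_nonneg _).isSelfAdjoint hG.res_isSelfAdjoint
    hG.commute_sqrt_one_sub_res n

theorem commute_res_specProj (hG : IsPositiveOp G) (n : ℕ) :
    Commute (res G) (specProj G n) :=
  commute_specProj hG.res_isSelfAdjoint hG.res_isSelfAdjoint (Commute.refl _) n

theorem commute_specProj_specProj (hG : IsPositiveOp G) (m n : ℕ) :
    Commute (specProj G m) (specProj G n) :=
  commute_specProj (specProj_isSelfAdjoint G m) hG.res_isSelfAdjoint
    (hG.commute_res_specProj m).symm n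

/-- Every cutoff is `(1 - R) V P_n` with `V` an inverse of the resolvent on the range of `P_n`. -/
theorem cutoff_eq (hG : IsPositiveOp G) (n : ℕ) {V : H →L[ℂ] H}
    (hV : res G * V * specProj G n = specProj G n) :
    cutoff G n = (1 - res G) * V * specProj G n := by
  have hV' : ∀ x, res G (V (specProj G n x)) = specProj G n x := fun x =>
    congrArg (fun T : H →L[ℂ] H => T x) hV
  have hmem : ∀ x, specProj G n x ∈ G.domain := fun x => hV' x ▸ hG.res_mem _
  have hval : ∀ x, G ⟨specProj G n x, hmem x⟩ = (1 - res G) (V (specProj G n x)) := fun x => by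
    rw [← hG.apply_res _ (hG.res_mem _)]
    congr 1
    exact Subtype.ext (hV' x).symm
  have h1 : IsCutoff G n (cutoff G n) :=
    Classical.epsilon_spec (p := IsCutoff G n)
      ⟨(1 - res G) * V * specProj G n, fun x => ⟨hmem x, (hval x).symm⟩⟩
  ext x
  obtain ⟨h, h'⟩ := h1 x
  exact h'.trans (hval x)

theorem cutoff_isSelfAdjoint (hG : IsPositiveOp G) (n : ℕ) : IsSelfAdjoint (cutoff G n) := by
  obtain ⟨V, hVs, hVc, hV⟩ := hG.exists_inverse_on_specProj n
  rw [hG.cutoff_eq n hV]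
  have h1 : Commute (1 - res G) V :=
    (Commute.one_left V).sub_left (hVc _ hG.res_isSelfAdjoint (Commute.refl _))
  have h2 : Commute (1 - res G) (specProj G n) :=
    (Commute.one_left _).sub_left (hG.commute_res_specProj n)
  have h3 : Commute V (specProj G n) :=
    (hVc _ (specProj_isSelfAdjoint G n) (hG.commute_res_specProj n).symm).symm
  have hR : IsSelfAdjoint (1 - res G) := (IsSelfAdjoint.one _).sub hG.res_isSelfAdjoint
  rw [← IsSelfAdjoint.commute_iff _ (specProj_isSelfAdjoint G n)]
  · exact h2.mul_left h3
  · exact (hR.commute_iff hVs).1 h1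

/-- With `φ = √R x` one has `√G φ = √(1 - R) x`, and commuting everything past `V` turns the left
side into `⟨√G φ, P_n √G φ⟩`. -/
theorem re_inner_cutoff_le (hG : IsPositiveOp G) (n : ℕ) (φ : (sqrtOp G).domain) :
    (⟪(φ : H), cutoff G n φ⟫_ℂ).re ≤ ‖sqrtOp G φ‖ ^ 2 := by
  obtain ⟨x, hx⟩ := (mem_domain_sqrtOp_iff G φ).1 φ.2
  obtain ⟨V, hVs, hVc, hV⟩ := hG.exists_inverse_on_specProj n
  rw [hG.sqrtOp_apply φ hx, hG.cutoff_eq n hV, ← hx]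
  set S := CFC.sqrt (res G) with hS
  set C := CFC.sqrt (1 - res G) with hC
  have hSs : IsSelfAdjoint S := (CFC.sqrt_nonneg _).isSelfAdjoint
  have hCs : IsSelfAdjoint C := (CFC.sqrt_nonneg _).isSelfAdjoint
  have hSS : S * S = res G := CFC.sqrt_mul_sqrt_self _ hG.res_nonneg
  have hCC : C * C = 1 - res G := CFC.sqrt_mul_sqrt_self _ hG.one_sub_res_nonneg
  have hSC : Commute S C := hG.commute_sqrt_sqrt
  have hSV : Commute S V := hVc _ hSs hG.commute_sqrt_res
  have hCV : Commute C V := hVc _ hCs hG.commute_sqrt_one_sub_res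
  have hSP := hG.commute_sqrt_specProj n
  have hCP := hG.commute_sqrt_one_sub_specProj n
  have key : S * ((1 - res G) * V * specProj G n * S) = C * specProj G n * C := by
    have e1 : Commute C (res G * V * specProj G n) := by rw [hV]; exact hCP
    calc S * ((1 - res G) * V * specProj G n * S)
        = S * (C * C * V * specProj G n) * S := by rw [hCC, mul_assoc S]
      _ = (C * C * V * specProj G n) * S * S := by
          rw [(((hSC.mul_right hSC).mul_right hSV).mul_right hSP).eq]
      _ = C * (C * (V * specProj G n * res G)) := by rw [← hSS]; simp only [mul_assoc]
      _ = C * (C * (res G * V * specProj G n)) := by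
          rw [← ((hVc _ hG.res_isSelfAdjoint (Commute.refl _)).mul_right
            (hG.commute_res_specProj n)).eq, mul_assoc (res G)]
      _ = C * specProj G n * C := by rw [e1.eq, hV, mul_assoc]
  have h1 : ⟪S x, ((1 - res G) * V * specProj G n) (S x)⟫_ℂ =
      ⟪C x, specProj G n (C x)⟫_ℂ := by
    rw [IsSelfAdjoint.inner_map hSs, IsSelfAdjoint.inner_map hCs]
    exact congrArg (fun T : H →L[ℂ] H => ⟪x, T x⟫_ℂ) key
  rw [h1, sq]
  exact (re_inner_le_norm (𝕜 := ℂ) _ _).trans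
    (mul_le_mul_of_nonneg_left (norm_specProj_apply_le G n _) (norm_nonneg _))

theorem specProj_mem (hG : IsPositiveOp G) (n : ℕ) (x : H) :
    specProj G n x ∈ (sqrtOp G).domain := by
  obtain ⟨V, hVs, hVc, hV⟩ := hG.exists_inverse_on_specProj n
  rw [mem_domain_sqrtOp_iff]
  refine ⟨CFC.sqrt (res G) (V (specProj G n x)), ?_⟩
  rw [← CFC.sqrt_mul_sqrt_self (res G) hG.res_nonneg] at hV
  exact congrArg (fun T : H →L[ℂ] H => T x) hV

/-- This trades the unbounded form of `√G` for the bounded operator `G P_n`, to which `Φ` can be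
applied. -/
theorem norm_sqrtOp_specProj_sq (hG : IsPositiveOp G) (n : ℕ) (x : H) :
    ‖sqrtOp G ⟨specProj G n x, hG.specProj_mem n x⟩‖ ^ 2 = (⟪x, cutoff G n x⟫_ℂ).re := by
  obtain ⟨V, hVs, hVc, hV⟩ := hG.exists_inverse_on_specProj n
  set P := specProj G n with hP
  have hV' : CFC.sqrt (res G) (CFC.sqrt (res G) (V (P x))) = P x := by
    have h := hV
    rw [← CFC.sqrt_mul_sqrt_self (res G) hG.res_nonneg] at h
    exact congrArg (fun T : H →L[ℂ] H => T x) h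
  rw [hG.sqrtOp_apply _ hV', norm_sqrt_apply_sq hG.one_sub_res_nonneg, hG.cutoff_eq n hV]
  set S := CFC.sqrt (res G) with hS
  have hSs : IsSelfAdjoint S := (CFC.sqrt_nonneg _).isSelfAdjoint
  have hSS : S * S = res G := CFC.sqrt_mul_sqrt_self _ hG.res_nonneg
  have hPs : IsSelfAdjoint P := specProj_isSelfAdjoint G n
  have hRV := hVc _ hG.res_isSelfAdjoint (Commute.refl _)
  have hPV : Commute P V := hVc _ hPs (hG.commute_res_specProj n).symm
  have hPR : Commute P (1 - res G) :=
    (Commute.one_right _).sub_right (hG.commute_res_specProj n).symm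
  have hVR : Commute V (1 - res G) := (Commute.one_right _).sub_right hRV.symm
  have hSR : Commute S (1 - res G) := (Commute.one_right _).sub_right hG.commute_sqrt_res
  have key : P * (V * (S * ((1 - res G) * (S * (V * P))))) = (1 - res G) * V * P := by
    calc P * (V * (S * ((1 - res G) * (S * (V * P)))))
        = P * V * (S * (1 - res G)) * (S * (V * P)) := by simp only [mul_assoc]
      _ = P * V * ((1 - res G) * S) * (S * (V * P)) := by rw [hSR.eq]
      _ = P * V * (1 - res G) * ((S * S) * V * P) := by simp only [mul_assoc]
      _ = P * V * (1 - res G) * P := by rw [hSS, hV]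
      _ = (1 - res G) * (P * V) * P := by rw [(hPR.mul_left hVR).eq]
      _ = (1 - res G) * V * (P * P) := by rw [hPV.eq]; simp only [mul_assoc]
      _ = (1 - res G) * V * P := by rw [hP, specProj_mul_self]
  rw [IsSelfAdjoint.inner_map hSs, IsSelfAdjoint.inner_map hVs, IsSelfAdjoint.inner_map hPs]
  exact congrArg (fun T : H →L[ℂ] H => (⟪x, T x⟫_ℂ).re) key

theorem cutoff_nonneg (hG : IsPositiveOp G) (n : ℕ) : 0 ≤ cutoff G n := by
  refine le_of_re_inner (IsSelfAdjoint.zero _) (hG.cutoff_isSelfAdjoint n) fun x => ?_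
  rw [← hG.norm_sqrtOp_specProj_sq]
  simp

theorem one_sub_specProj_mem (hG : IsPositiveOp G) (n : ℕ) (φ : (sqrtOp G).domain) :
    (1 - specProj G n) (φ : H) ∈ (sqrtOp G).domain :=
  Submodule.sub_mem _ φ.2 (hG.specProj_mem n φ)

/-- For `φ = √R x` and `y = (1 - P_n) x` it suffices that `n ⟨y, R y⟩ ≤ ⟨y, (1 - R) y⟩`, which is
the resolvent bound on the spectral subspace of `(n, ∞)`. -/
theorem norm_one_sub_specProj_sq_le (hG : IsPositiveOp G) (n : ℕ) (φ : (sqrtOp G).domain) :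
    n * ‖(1 - specProj G n) (φ : H)‖ ^ 2 ≤ ‖sqrtOp G φ‖ ^ 2 := by
  obtain ⟨x, hx⟩ := (mem_domain_sqrtOp_iff G φ).1 φ.2
  rw [hG.sqrtOp_apply φ hx, ← hx]
  have h1 : Commute (1 - specProj G n) (CFC.sqrt (res G)) :=
    (Commute.one_left _).sub_left (hG.commute_sqrt_specProj n).symm
  have h2 : Commute (1 - specProj G n) (CFC.sqrt (1 - res G)) :=
    (Commute.one_left _).sub_left (hG.commute_sqrt_one_sub_specProj n).symm
  have h1' : (1 - specProj G n) (CFC.sqrt (res G) x) =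
      CFC.sqrt (res G) ((1 - specProj G n) x) := congrArg (fun T : H →L[ℂ] H => T x) h1.eq
  have h2' : (1 - specProj G n) (CFC.sqrt (1 - res G) x) =
      CFC.sqrt (1 - res G) ((1 - specProj G n) x) := congrArg (fun T : H →L[ℂ] H => T x) h2.eq
  have h3 := norm_one_sub_specProj_apply_le G n (CFC.sqrt (1 - res G) x)
  have h4 := pow_le_pow_left₀ (norm_nonneg _) h3 2
  rw [h2', norm_sqrt_apply_sq hG.one_sub_res_nonneg] at h4
  rw [h1', norm_sqrt_apply_sq hG.res_nonneg]
  refine le_trans ?_ h4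
  have h5 := hG.re_inner_res_one_sub_specProj_le n x
  set y := (1 - specProj G n) x
  change _ ≤ (⟪y, y - res G y⟫_ℂ).re
  rw [inner_sub_right, Complex.sub_re]
  have h6 : (⟪y, y⟫_ℂ).re = ‖y‖ ^ 2 := inner_self_eq_norm_sq (𝕜 := ℂ) _
  linarith

theorem norm_sqrtOp_one_sub_specProj_le (hG : IsPositiveOp G) (n : ℕ) (φ : (sqrtOp G).domain) :
    ‖sqrtOp G ⟨_, hG.one_sub_specProj_mem n φ⟩‖ ≤ ‖sqrtOp G φ‖ := by
  obtain ⟨x, hx⟩ := (mem_domain_sqrtOp_iff G φ).1 φ.2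
  have h1 : Commute (1 - specProj G n) (CFC.sqrt (res G)) :=
    (Commute.one_left _).sub_left (hG.commute_sqrt_specProj n).symm
  have h2 : Commute (1 - specProj G n) (CFC.sqrt (1 - res G)) :=
    (Commute.one_left _).sub_left (hG.commute_sqrt_one_sub_specProj n).symm
  have h1' : (1 - specProj G n) (CFC.sqrt (res G) x) =
      CFC.sqrt (res G) ((1 - specProj G n) x) := congrArg (fun T : H →L[ℂ] H => T x) h1.eq
  have h2' : (1 - specProj G n) (CFC.sqrt (1 - res G) x) =
      CFC.sqrt (1 - res G) ((1 - specProj G n) x) := congrArg (fun T : H →L[ℂ] H => T x) h2.eq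
  rw [hG.sqrtOp_apply φ hx, hG.sqrtOp_apply (x := (1 - specProj G n) x) _ (by rw [← h1', hx]),
    ← h2']
  exact norm_one_sub_specProj_apply_le G n _

theorem dense_domain_sqrtOp (hG : IsPositiveOp G) : Dense ((sqrtOp G).domain : Set H) := by
  refine hG.selfAdjoint.dense_domain.mono fun x hx => ?_
  refine (mem_domain_sqrtOp_iff G x).2 ⟨CFC.sqrt (res G) (x + G ⟨x, hx⟩), ?_⟩
  have h := congrArg (fun T : H →L[ℂ] H => T (x + G ⟨x, hx⟩))
    (CFC.sqrt_mul_sqrt_self (res G) hG.res_nonneg)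
  exact h.trans (hG.res_apply_add ⟨x, hx⟩)

/-- On `D(√G)` the squared norm is at most `‖√G φ‖² / n`; density of `D(√G)` and the contractivity
of `1 - P_n` do the rest. -/
theorem tendsto_one_sub_specProj (hG : IsPositiveOp G) (x : H) :
    Filter.Tendsto (fun n => (1 - specProj G n) x) Filter.atTop (nhds 0) := by
  have hD : ∀ φ : (sqrtOp G).domain,
      Filter.Tendsto (fun n => (1 - specProj G n) (φ : H)) Filter.atTop (nhds 0) := fun φ => by
    rw [tendsto_zero_iff_norm_tendsto_zero]
    have h1 : Filter.Tendsto (fun n : ℕ => ‖sqrtOp G φ‖ ^ 2 / n) Filter.atTop (nhds 0) :=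
      tendsto_const_div_atTop_nhds_zero_nat _
    have h2 : Filter.Tendsto (fun n : ℕ => ‖(1 - specProj G n) (φ : H)‖ ^ 2) Filter.atTop
        (nhds 0) := by
      refine squeeze_zero' (Filter.Eventually.of_forall fun n => sq_nonneg _) ?_ h1
      filter_upwards [Filter.eventually_gt_atTop 0] with n hn
      rw [le_div_iff₀ (by exact_mod_cast hn), mul_comm]
      exact hG.norm_one_sub_specProj_sq_le n φ
    simpa using h2.sqrt
  rw [Metric.tendsto_atTop]
  intro ε hε
  obtain ⟨φ, hφ, hd⟩ := hG.dense_domain_sqrtOp.exists_dist_lt x (half_pos hε)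
  obtain ⟨N, hN⟩ := Metric.tendsto_atTop.1 (hD ⟨φ, hφ⟩) (ε / 2) (half_pos hε)
  refine ⟨N, fun n hn => ?_⟩
  have h1 := hN n hn
  rw [dist_zero_right] at h1 ⊢
  have h2 : (1 - specProj G n) x = (1 - specProj G n) (x - φ) + (1 - specProj G n) φ := by
    rw [← map_add, sub_add_cancel]
  rw [h2]
  have h3 := norm_one_sub_specProj_apply_le G n (x - φ)
  rw [dist_eq_norm] at hd
  exact (norm_add_le _ _).trans_lt (by simp only at h1; linarith)

/-- For `ψ ∈ D(G)` of norm one, `‖√G ψ‖² = ⟨ψ, G ψ⟩ ≤ ‖G ψ‖`. -/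
theorem exists_low_energy (hG : IsPositiveOp G) (hG0 : InfZero G) {ε : ℝ} (hε : 0 < ε) :
    ∃ φ : (sqrtOp G).domain, ‖(φ : H)‖ = 1 ∧ ‖sqrtOp G φ‖ ^ 2 ≤ ε := by
  obtain ⟨_, ⟨ψ, hψ, rfl⟩, _, hlt⟩ := hG0.exists_between hε
  have hR := hG.res_apply_add ψ
  set y := (ψ : H) + G ψ with hy
  have hSS : CFC.sqrt (res G) (CFC.sqrt (res G) y) = ψ := by
    have h := congrArg (fun T : H →L[ℂ] H => T y)
      (CFC.sqrt_mul_sqrt_self (res G) hG.res_nonneg)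
    exact h.trans hR
  refine ⟨⟨ψ, (mem_domain_sqrtOp_iff G _).2 ⟨_, hSS⟩⟩, hψ, ?_⟩
  rw [hG.sqrtOp_apply _ hSS, norm_sqrt_apply_sq hG.one_sub_res_nonneg]
  have hc : Commute (CFC.sqrt (res G)) (1 - res G) :=
    (Commute.one_right _).sub_right hG.commute_sqrt_res
  have hc' : (1 - res G) (CFC.sqrt (res G) y) = CFC.sqrt (res G) ((1 - res G) y) :=
    (congrArg (fun T : H →L[ℂ] H => T y) hc.eq).symm
  have hGy : (1 - res G) y = G ψ := by
    change y - res G y = G ψ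
    rw [hR, hy, add_sub_cancel_left]
  rw [hc', hGy, ← IsSelfAdjoint.inner_map (CFC.sqrt_nonneg (res G)).isSelfAdjoint, hSS]
  refine (re_inner_le_norm (𝕜 := ℂ) _ _).trans ?_
  rw [hψ, one_mul]
  exact hlt.le

end IsPositiveOp

end EnergyNorm

/-! ### The S-lemma for Hermitian forms. -/

namespace EnergyNorm

/-- A rotation makes `u * b` purely imaginary, which leaves the sign of `u` free to fix the second
condition. In the S-lemma `b` and `c` are the cross terms of the two forms. -/
theorem exists_phase (b c : ℂ) : ∃ u : ℂ, ‖u‖ = 1 ∧ (u * b).re = 0 ∧ (u * c).re ≤ 0 := by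
  obtain ⟨u, hu, hb⟩ : ∃ u : ℂ, ‖u‖ = 1 ∧ (u * b).re = 0 := by
    by_cases h : b = 0
    · exact ⟨1, by simp, by simp [h]⟩
    · have hn : (‖b‖ : ℂ) ≠ 0 := by exact_mod_cast norm_ne_zero_iff.2 h
      refine ⟨Complex.I * (starRingEnd ℂ b / ‖b‖), ?_, ?_⟩
      · simp [norm_ne_zero_iff.2 h]
      · have : Complex.I * (starRingEnd ℂ b / ‖b‖) * b = Complex.I * (‖b‖ : ℂ) := by
          rw [mul_assoc, div_mul_eq_mul_div, mul_comm (starRingEnd ℂ b), Complex.mul_conj,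
            Complex.normSq_eq_norm_sq]
          push_cast
          field_simp
        rw [this]
        simp
  rcases le_total (u * c).re 0 with h | h
  · exact ⟨u, hu, hb, h⟩
  · refine ⟨-u, by rwa [norm_neg], ?_, ?_⟩
    · rw [neg_mul, Complex.neg_re, hb, neg_zero]
    · rw [neg_mul, Complex.neg_re]
      linarith

section SLemma

variable {H : Type*} [NormedAddCommGroup H] [InnerProductSpace ℂ H]
  {V : Type*} [AddCommGroup V] [Module ℂ V]

theorem norm_add_smul_sq (x y : H) (z : ℂ) :
    ‖x + z • y‖ ^ 2 = ‖x‖ ^ 2 + ‖z‖ ^ 2 * ‖y‖ ^ 2 + 2 * (z * ⟪x, y⟫_ℂ).re := by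
  have h := norm_add_sq (𝕜 := ℂ) x (z • y)
  rw [inner_smul_right, norm_smul, mul_pow] at h
  simp only [RCLike.re_eq_complex_re] at h
  linarith

/-- The S-lemma for two Hermitian forms `e ‖J v‖² - ‖S v‖²` and `F ‖J v‖² - ‖A v‖²`. -/
theorem exists_dominating_form (J S A : V →ₗ[ℂ] H) (hJ : Function.Injective J)
    (hlow : ∀ ε > 0, ∃ v, ‖J v‖ = 1 ∧ ‖S v‖ ^ 2 ≤ ε) {e F : ℝ} (he : 0 < e)
    (h : ∀ v, ‖J v‖ = 1 → ‖S v‖ ^ 2 ≤ e → ‖A v‖ ^ 2 ≤ F) :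
    ∃ α κ : ℝ, 0 ≤ α ∧ 0 ≤ κ ∧ α + κ * e = F ∧
      ∀ v, ‖A v‖ ^ 2 ≤ α * ‖J v‖ ^ 2 + κ * ‖S v‖ ^ 2 := by
  have hom : ∀ v, ‖S v‖ ^ 2 ≤ e * ‖J v‖ ^ 2 → ‖A v‖ ^ 2 ≤ F * ‖J v‖ ^ 2 := fun v hv => by
    by_cases h0 : J v = 0
    · have : v = 0 := hJ (by rw [h0, map_zero])
      simp [this]
    · have hn : 0 < ‖J v‖ := norm_pos_iff.2 h0
      have hz : ‖(((‖J v‖⁻¹ : ℝ)) : ℂ)‖ = ‖J v‖⁻¹ := by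
        rw [Complex.norm_real, Real.norm_of_nonneg (by positivity)]
      have h1 := h (((‖J v‖⁻¹ : ℝ) : ℂ) • v) (by
        rw [map_smul, norm_smul, hz, inv_mul_cancel₀ hn.ne']) (by
        rw [map_smul, norm_smul, hz, mul_pow, inv_pow, inv_mul_le_iff₀ (by positivity)]
        linarith)
      rw [map_smul, norm_smul, hz, mul_pow, inv_pow, inv_mul_le_iff₀ (by positivity)] at h1
      linarith
  let q : V → ℝ := fun v => e * ‖J v‖ ^ 2 - ‖S v‖ ^ 2
  let p : V → ℝ := fun v => F * ‖J v‖ ^ 2 - ‖A v‖ ^ 2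
  have hpq : ∀ v, 0 ≤ q v → 0 ≤ p v := fun v hv =>
    sub_nonneg.2 (hom v (sub_nonneg.1 hv))
  -- Add to `v` a multiple `t u w` with `t² = -q v / q w` and a phase `u` that kills the cross term
  -- of `q` and makes that of `p` nonpositive. Then `q` vanishes on the sum, so `p ≥ 0` there, which
  -- gives `p v + t² p w ≥ 0`.
  have cross : ∀ v w, q v < 0 → 0 < q w → q v * p w ≤ p v * q w := fun v w hv hw => by
    obtain ⟨u, hu, hb, hc⟩ := exists_phase (e * ⟪J v, J w⟫_ℂ - ⟪S v, S w⟫_ℂ)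
      (F * ⟪J v, J w⟫_ℂ - ⟪A v, A w⟫_ℂ)
    set t := √(-q v / q w) with ht
    have ht2 : t ^ 2 * q w = -q v := by
      rw [ht, Real.sq_sqrt (div_nonneg (by linarith) hw.le), div_mul_cancel₀ _ hw.ne']
    have ht0 : 0 ≤ t := Real.sqrt_nonneg _
    have hz : ‖(t : ℂ) * u‖ ^ 2 = t ^ 2 := by
      rw [norm_mul, hu, mul_one, Complex.norm_real, Real.norm_of_nonneg ht0]
    have expand : ∀ (r : ℝ) (B : V →ₗ[ℂ] H),
        r * ‖J (v + ((t : ℂ) * u) • w)‖ ^ 2 - ‖B (v + ((t : ℂ) * u) • w)‖ ^ 2 =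
          (r * ‖J v‖ ^ 2 - ‖B v‖ ^ 2) + t ^ 2 * (r * ‖J w‖ ^ 2 - ‖B w‖ ^ 2) +
            2 * t * (u * (r * ⟪J v, J w⟫_ℂ - ⟪B v, B w⟫_ℂ)).re := fun r B => by
      rw [map_add, map_add, map_smul, map_smul, norm_add_smul_sq, norm_add_smul_sq, hz]
      have e1 : ∀ c : ℂ, ((t : ℂ) * u * c).re = t * (u * c).re := fun c => by
        rw [mul_assoc, Complex.re_ofReal_mul]
      have e2 : (u * (r * ⟪J v, J w⟫_ℂ - ⟪B v, B w⟫_ℂ)).re =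
          r * (u * ⟪J v, J w⟫_ℂ).re - (u * ⟪B v, B w⟫_ℂ).re := by
        rw [mul_sub, Complex.sub_re, mul_left_comm, Complex.re_ofReal_mul]
      rw [e1, e1, e2]
      ring
    have hq : q (v + ((t : ℂ) * u) • w) = 0 := by
      refine (expand e S).trans ?_
      rw [hb]
      change q v + t ^ 2 * q w + _ = 0
      rw [ht2]
      ring
    have hp := hpq _ hq.ge
    have hp2 : p (v + ((t : ℂ) * u) • w) = p v + t ^ 2 * p w + 2 * t * _ := expand F A
    have h3 : 0 ≤ p v + t ^ 2 * p w := by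
      have := mul_nonneg ht0 (neg_nonneg.2 hc)
      linarith
    have h4 := mul_nonneg h3 hw.le
    have h5 : (p v + t ^ 2 * p w) * q w = p v * q w + (t ^ 2 * q w) * p w := by ring
    rw [h5, ht2] at h4
    linarith
  -- The multiplier is `κ = inf p / q` over `q > 0`. By `cross`, every ratio `p v / q v` with `q v <
  -- 0` lies below all of `K`, so `κ q ≤ p` everywhere.
  let K : Set ℝ := {r | ∃ w, 0 < q w ∧ r = p w / q w}
  have hK0 : ∀ r ∈ K, 0 ≤ r := by
    rintro _ ⟨w, hw, rfl⟩
    exact div_nonneg (hpq w hw.le) hw.le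
  have hKb : BddBelow K := ⟨0, hK0⟩
  have hKn : K.Nonempty := by
    obtain ⟨w, hw, hw'⟩ := hlow (e / 2) (half_pos he)
    refine ⟨_, w, ?_, rfl⟩
    change 0 < e * ‖J w‖ ^ 2 - ‖S w‖ ^ 2
    rw [hw]
    linarith
  have hκ : 0 ≤ sInf K := le_csInf hKn hK0
  have hmain : ∀ v, sInf K * q v ≤ p v := fun v => by
    rcases lt_trichotomy (q v) 0 with hv | hv | hv
    · have : p v / q v ≤ sInf K := by
        refine le_csInf hKn ?_
        rintro _ ⟨w, hw, rfl⟩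
        rw [div_le_iff_of_neg hv, div_mul_eq_mul_div, div_le_iff₀ hw]
        have := cross v w hv hw
        linarith
      rwa [div_le_iff_of_neg hv] at this
    · rw [hv, mul_zero]
      exact hpq v hv.ge
    · rw [← le_div_iff₀ hv]
      exact csInf_le hKb ⟨v, hv, rfl⟩
  have hmain' : ∀ v, ‖A v‖ ^ 2 ≤ (F - sInf K * e) * ‖J v‖ ^ 2 + sInf K * ‖S v‖ ^ 2 := fun v => by
    have h1 : sInf K * (e * ‖J v‖ ^ 2 - ‖S v‖ ^ 2) ≤ F * ‖J v‖ ^ 2 - ‖A v‖ ^ 2 := hmain v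
    linarith
  refine ⟨F - sInf K * e, sInf K, ?_, hκ, by ring, hmain'⟩
  by_contra hneg
  push Not at hneg
  -- If `α = F - κ e` were negative, a unit vector of energy this small would have `κ ‖S w‖² ≤ -α /
  -- 2` and thus `‖A w‖² ≤ α / 2 < 0`. The `+ 1` covers `κ = 0`.
  obtain ⟨w, hw, hw'⟩ := hlow (-(F - sInf K * e) / (2 * (sInf K + 1)))
    (div_pos (by linarith) (by linarith))
  have h1 := hmain' w
  rw [hw] at h1
  have h2 : sInf K * ‖S w‖ ^ 2 ≤ -(F - sInf K * e) / 2 := by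
    calc sInf K * ‖S w‖ ^ 2 ≤ (sInf K + 1) * (-(F - sInf K * e) / (2 * (sInf K + 1))) := by
          gcongr
          linarith
      _ = -(F - sInf K * e) / 2 := by field_simp
  nlinarith [sq_nonneg ‖A w‖]

end SLemma

end EnergyNorm

/-! ### Traces against positive trace class operators. -/

namespace EnergyNorm

variable {H : Type*} [NormedAddCommGroup H] [InnerProductSpace ℂ H]

theorem hasSum_norm_inner_sq {ι : Type*} (b : HilbertBasis ι ℂ H) (x : H) :
    HasSum (fun i => ‖⟪b i, x⟫_ℂ‖ ^ 2) (‖x‖ ^ 2) := by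
  have h := Complex.hasSum_re (b.hasSum_inner_mul_inner x x)
  have h2 : (⟪x, x⟫_ℂ).re = ‖x‖ ^ 2 := inner_self_eq_norm_sq (𝕜 := ℂ) _
  rw [h2] at h
  convert h using 2 with i
  rw [← inner_conj_symm (b i) x, RCLike.norm_conj, Complex.mul_conj, Complex.normSq_eq_norm_sq,
    Complex.ofReal_re]

theorem summable_norm_inner_sq_prod {ι : Type*} (b : HilbertBasis ι ℂ H) {T : H →L[ℂ] H}
    (hT : Summable fun i => ‖T (b i)‖ ^ 2) :
    Summable fun q : ι × ι => ‖⟪b q.2, T (b q.1)⟫_ℂ‖ ^ 2 := by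
  refine (summable_prod_of_nonneg fun q => sq_nonneg _).2 ⟨fun j => ?_, ?_⟩
  · exact (hasSum_norm_inner_sq b (T (b j))).summable
  · exact hT.congr fun j => (hasSum_norm_inner_sq b (T (b j))).tsum_eq.symm

/-- Fubini for a product of two square-summable families, which is absolutely summable since `|f g|
≤ |f|² + |g|²`. -/
theorem hasSum_swap {ι : Type*} {f g : ι × ι → ℂ} (hf : Summable fun q => ‖f q‖ ^ 2)
    (hg : Summable fun q => ‖g q‖ ^ 2) {r s : ι → ℂ}
    (hr : ∀ j, HasSum (fun i => f (j, i) * g (j, i)) (r j))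
    (hs : ∀ i, HasSum (fun j => f (j, i) * g (j, i)) (s i)) : HasSum r (∑' i, s i) := by
  have h : Summable fun q => f q * g q := by
    refine Summable.of_norm_bounded (hf.add hg) fun q => ?_
    rw [norm_mul]
    nlinarith [sq_nonneg (‖f q‖ - ‖g q‖), sq_nonneg ‖f q‖, sq_nonneg ‖g q‖]
  have h1 := h.hasSum.prod_fiberwise hr
  have h2 := ((Equiv.prodComm ι ι).hasSum_iff.2 h.hasSum).prod_fiberwise hs
  rwa [h2.tsum_eq]

variable [CompleteSpace H]

theorem summable_norm_sqrt_sq {σ : H →L[ℂ] H} (h0 : 0 ≤ σ) (hσ : IsTraceClass σ) :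
    Summable fun i => ‖CFC.sqrt σ (basis H i)‖ ^ 2 := by
  refine Summable.congr hσ fun i => ?_
  rw [norm_sqrt_apply_sq h0, CFC.abs_of_nonneg σ h0]

/-- Cyclicity of the trace for a Hilbert-Schmidt operator `S`: `Tr X S S = Tr S X S`. -/
theorem hasSum_inner_cyclic {ι : Type*} (b : HilbertBasis ι ℂ H) {S : H →L[ℂ] H}
    (hS : IsSelfAdjoint S) (hsum : Summable fun i => ‖S (b i)‖ ^ 2) (X : H →L[ℂ] H) :
    HasSum (fun j => ⟪S (b j), X (S (b j))⟫_ℂ) (∑' i, ⟪b i, X (S (S (b i)))⟫_ℂ) := by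
  have hX : Summable fun i => ‖(X * S) (b i)‖ ^ 2 := by
    refine Summable.of_nonneg_of_le (fun j => sq_nonneg _) (fun j => ?_)
      (hsum.mul_left (‖X‖ ^ 2))
    rw [← mul_pow]
    exact pow_le_pow_left₀ (norm_nonneg _) (X.le_opNorm _) 2
  have h1 : Summable fun q : ι × ι => ‖⟪S (b q.1), b q.2⟫_ℂ‖ ^ 2 :=
    (summable_norm_inner_sq_prod b hsum).congr fun q => by rw [norm_inner_symm]
  refine hasSum_swap h1 (summable_norm_inner_sq_prod b hX)
    (fun j => b.hasSum_inner_mul_inner (S (b j)) (X (S (b j)))) fun i => ?_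
  have h := b.hasSum_inner_mul_inner (S (X.adjoint (b i))) (S (b i))
  rw [IsSelfAdjoint.inner_map hS, ContinuousLinearMap.adjoint_inner_left] at h
  have e : (fun j => ⟪S (b j), b i⟫_ℂ * ⟪b i, (X * S) (b j)⟫_ℂ) =
      fun j => ⟪S (X.adjoint (b i)), b j⟫_ℂ * ⟪b j, S (b i)⟫_ℂ := by
    funext j
    rw [IsSelfAdjoint.inner_map hS (X.adjoint (b i)), ContinuousLinearMap.adjoint_inner_left,
      IsSelfAdjoint.inner_map hS (b j), mul_comm]
    rfl
  exact e ▸ h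

/-- Writing the trace as a sum of `⟨s_j, X s_j⟩` with `s_j = √σ e_j` and `∑ ‖s_j‖² < ∞` allows
inequalities and limits in `X` to be handled term by term. -/
theorem hasSum_trace {σ : H →L[ℂ] H} (h0 : 0 ≤ σ) (hσ : IsTraceClass σ) (X : H →L[ℂ] H) :
    HasSum (fun j => ⟪CFC.sqrt σ (basis H j), X (CFC.sqrt σ (basis H j))⟫_ℂ)
      (trace (X * σ)) := by
  have h := hasSum_inner_cyclic (basis H) (CFC.sqrt_nonneg σ).isSelfAdjoint
    (summable_norm_sqrt_sq h0 hσ) X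
  have e : ∀ x, CFC.sqrt σ (CFC.sqrt σ x) = σ x := fun x =>
    congrArg (fun T : H →L[ℂ] H => T x) (CFC.sqrt_mul_sqrt_self σ h0)
  simp_rw [e] at h
  exact h

theorem apply_sqrt_eq_zero_of_trace {σ : H →L[ℂ] H} (h0 : 0 ≤ σ) (hσ : IsTraceClass σ)
    {X : H →L[ℂ] H} (hX : 0 ≤ X) (h : (trace (X * σ)).re = 0) (i : basisIndex H) :
    X (CFC.sqrt σ (basis H i)) = 0 := by
  have h1 := Complex.hasSum_re (hasSum_trace h0 hσ X)
  rw [h] at h1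
  have h2 := congrFun ((hasSum_zero_iff_of_nonneg fun _ => re_inner_nonneg hX _).1 h1) i
  rw [Pi.zero_apply, ← norm_sqrt_apply_sq hX] at h2
  have h3 : CFC.sqrt X (CFC.sqrt σ (basis H i)) = 0 :=
    norm_eq_zero.1 ((pow_eq_zero_iff two_ne_zero).1 h2)
  have h4 := congrArg (fun T : H →L[ℂ] H => T (CFC.sqrt σ (basis H i)))
    (CFC.sqrt_mul_sqrt_self X hX)
  refine h4.symm.trans ?_
  change CFC.sqrt X (CFC.sqrt X _) = 0
  rw [h3, map_zero]

/-- Functionals `X ↦ Tr X σ` are normal. -/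
theorem tendsto_trace_mul {σ : H →L[ℂ] H} (h0 : 0 ≤ σ) (hσ : IsTraceClass σ)
    {X : ℕ → H →L[ℂ] H} (hb : ∀ n x, ‖X n x‖ ≤ ‖x‖)
    (hX : ∀ x, Filter.Tendsto (fun n => X n x) Filter.atTop (nhds 0)) :
    Filter.Tendsto (fun n => trace (X n * σ)) Filter.atTop (nhds 0) := by
  have h1 : ∀ n, trace (X n * σ) =
      ∑' j, ⟪CFC.sqrt σ (basis H j), X n (CFC.sqrt σ (basis H j))⟫_ℂ :=
    fun n => (hasSum_trace h0 hσ (X n)).tsum_eq.symm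
  simp_rw [h1]
  rw [← tsum_zero (β := basisIndex H)]
  -- The dominating series is `∑ ‖√σ e_j‖²`.
  refine tendsto_tsum_of_dominated_convergence (summable_norm_sqrt_sq h0 hσ) (fun j => ?_)
    (Filter.Eventually.of_forall fun n j => ?_)
  · simpa using (tendsto_const_nhds (x := CFC.sqrt σ (basis H j))).inner (𝕜 := ℂ)
      (hX (CFC.sqrt σ (basis H j)))
  · rw [sq]
    exact (norm_inner_le_norm _ _).trans (mul_le_mul_of_nonneg_left (hb n _) (norm_nonneg _))

theorem trace_mul_rankOne (X : H →L[ℂ] H) (x y : H) :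
    trace (X * InnerProductSpace.rankOne ℂ x y) = ⟪y, X x⟫_ℂ := by
  rw [← ((basis H).hasSum_inner_mul_inner y (X x)).tsum_eq, trace]
  refine tsum_congr fun i => ?_
  rw [mul_apply_eq_comp, InnerProductSpace.rankOne_apply, map_smul, inner_smul_right]

theorem trace_rankOne_mul (X : H →L[ℂ] H) (x y : H) :
    trace (InnerProductSpace.rankOne ℂ x y * X) = ⟪y, X x⟫_ℂ := by
  rw [← X.adjoint_inner_left, ← ((basis H).hasSum_inner_mul_inner (X.adjoint y) x).tsum_eq, trace]
  refine tsum_congr fun i => ?_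
  rw [mul_apply_eq_comp, InnerProductSpace.rankOne_apply, inner_smul_right,
    X.adjoint_inner_left]

theorem isTraceClass_rankOne (x : H) : IsTraceClass (InnerProductSpace.rankOne ℂ x x) := by
  have h0 : 0 ≤ InnerProductSpace.rankOne ℂ x x :=
    (ContinuousLinearMap.nonneg_iff_isPositive _).2 (InnerProductSpace.isPositive_rankOne_self x)
  refine (Complex.hasSum_re ((basis H).hasSum_inner_mul_inner x x)).summable.congr fun i => ?_
  rw [CFC.abs_of_nonneg _ h0, InnerProductSpace.rankOne_apply, inner_smul_right]

/-- The pure state with vector `φ` (unnormalized). -/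
noncomputable def pure (φ : H) : TraceClass H :=
  ⟨InnerProductSpace.rankOne ℂ φ φ, isTraceClass_rankOne φ⟩

theorem pure_nonneg (φ : H) : 0 ≤ (pure φ).1 :=
  (ContinuousLinearMap.nonneg_iff_isPositive _).2 (InnerProductSpace.isPositive_rankOne_self φ)

end EnergyNorm

/-! ### Two-positive maps, Kadison's inequality and the predual map. -/

namespace EnergyNorm

variable {H : Type*} [NormedAddCommGroup H] [InnerProductSpace ℂ H] [CompleteSpace H]

theorem exists_eq_star_mul_self {A : Type*} [NonUnitalCStarAlgebra A] [PartialOrder A]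
    [StarOrderedRing A] {a : A} (h : 0 ≤ a) : ∃ b, a = star b * b :=
  CStarAlgebra.nonneg_iff_eq_star_mul_self.1 h

namespace IsTwoPositive

variable {Φ : (H →L[ℂ] H) →ₗ[ℂ] (H →L[ℂ] H)}

/-- The matrix with rows `(1, B)` and `(B*, B*B)` is `V* V` for `V` with rows `(1, B)` and `(0, 0)`.
Its image under `Φ` is positive, hence of the form `N* N`; Cauchy-Schwarz for the columns of `N` is
then Kadison's inequality. -/
theorem exists_factorization (hΦ : IsTwoPositive Φ) (B : H →L[ℂ] H) :
    ∃ N : Fin 2 → Fin 2 → (H →L[ℂ] H),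
      Φ 1 = ∑ k, star (N k 0) * N k 0 ∧ Φ B = ∑ k, star (N k 0) * N k 1 ∧
        Φ (star B * B) = ∑ k, star (N k 1) * N k 1 := by
  let V : CStarMatrix (Fin 2) (Fin 2) (H →L[ℂ] H) := CStarMatrix.ofMatrix !![1, B; 0, 0]
  obtain ⟨N, hN⟩ := exists_eq_star_mul_self (hΦ (star V * V) (star_mul_self_nonneg V))
  have h : ∀ i j, Φ ((star V * V) i j) = ∑ k, star (N k i) * N k j := fun i j => by
    have := congrFun (congrFun hN i) j
    rw [CStarMatrix.mul_apply] at this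
    exact this
  have h' : ∀ i j, (star V * V) i j = ∑ k, star (V k i) * V k j := fun i j => by
    rw [CStarMatrix.mul_apply]
    rfl
  have v00 : V 0 0 = 1 := rfl
  have v01 : V 0 1 = B := rfl
  have v10 : V 1 0 = 0 := rfl
  have v11 : V 1 1 = 0 := rfl
  refine ⟨fun k i => N k i, ?_, ?_, ?_⟩
  · rw [← h 0 0, h' 0 0]
    simp [Fin.sum_univ_two, v00, v10]
  · rw [← h 0 1, h' 0 1]
    simp [Fin.sum_univ_two, v00, v10, v01, v11]
  · rw [← h 1 1, h' 1 1]
    simp [Fin.sum_univ_two, v01, v11]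

theorem map_nonneg (hΦ : IsTwoPositive Φ) {A : H →L[ℂ] H} (hA : 0 ≤ A) : 0 ≤ Φ A := by
  obtain ⟨B, rfl⟩ := exists_eq_star_mul_self hA
  obtain ⟨N, -, -, h⟩ := hΦ.exists_factorization B
  rw [h]
  exact Finset.sum_nonneg fun k _ => star_mul_self_nonneg _

theorem mono (hΦ : IsTwoPositive Φ) {A B : H →L[ℂ] H} (h : A ≤ B) : Φ A ≤ Φ B := by
  have := hΦ.map_nonneg (sub_nonneg.2 h)
  rwa [map_sub, sub_nonneg] at this

/-- Kadison's inequality for 2-positive maps. -/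
theorem norm_map_apply_sq_le (hΦ : IsTwoPositive Φ) (B : H →L[ℂ] H) (x : H) :
    ‖Φ B x‖ ^ 2 ≤ ‖Φ 1‖ * (⟪x, Φ (star B * B) x⟫_ℂ).re := by
  obtain ⟨N, h1, h2, h3⟩ := hΦ.exists_factorization B
  have hin : ∀ (i j : Fin 2) (y z : H),
      ⟪y, (∑ k, star (N k i) * N k j) z⟫_ℂ = ∑ k, ⟪N k i y, N k j z⟫_ℂ := fun i j y z => by
    rw [sum_apply, inner_sum]
    refine Finset.sum_congr rfl fun k _ => ?_
    rw [mul_apply_eq_comp, ContinuousLinearMap.star_eq_adjoint,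
      ContinuousLinearMap.adjoint_inner_right]
  have hsq : ∀ (i : Fin 2) (y : H),
      (⟪y, (∑ k, star (N k i) * N k i) y⟫_ℂ).re = ∑ k, ‖N k i y‖ ^ 2 := fun i y => by
    rw [hin, Complex.re_sum]
    exact Finset.sum_congr rfl fun k _ => inner_self_eq_norm_sq (𝕜 := ℂ) _
  -- With this `y`, Cauchy-Schwarz reads `‖y‖⁴ ≤ ⟨y, Φ(1) y⟩ ⟨x, Φ(B*B) x⟩`; bounding the first
  -- factor by `‖Φ(1)‖ ‖y‖²` and dividing by `‖y‖²` gives the claim.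
  set y := Φ B x with hy
  have e0 := hsq 0 y
  have e1 := hsq 1 x
  rw [← h1] at e0
  rw [← h3] at e1
  have e2 : ‖y‖ ^ 2 ≤ ∑ k, ‖N k 0 y‖ * ‖N k 1 x‖ := by
    have : (⟪y, Φ B x⟫_ℂ).re = ‖y‖ ^ 2 := inner_self_eq_norm_sq (𝕜 := ℂ) _
    rw [← this, h2, hin, Complex.re_sum]
    exact Finset.sum_le_sum fun k _ => re_inner_le_norm (𝕜 := ℂ) _ _
  have e3 : (∑ k, ‖N k 0 y‖ * ‖N k 1 x‖) ^ 2 ≤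
      (⟪y, Φ 1 y⟫_ℂ).re * (⟪x, Φ (star B * B) x⟫_ℂ).re := by
    rw [e0, e1]
    exact Finset.sum_mul_sq_le_sq_mul_sq _ _ _
  have e4 : (⟪y, Φ 1 y⟫_ℂ).re ≤ ‖Φ 1‖ * ‖y‖ ^ 2 := by
    refine (re_inner_le_norm (𝕜 := ℂ) _ _).trans ?_
    have := mul_le_mul_of_nonneg_left ((Φ 1).le_opNorm y) (norm_nonneg y)
    linarith
  have e5 : 0 ≤ (⟪x, Φ (star B * B) x⟫_ℂ).re := by
    rw [e1]; positivity
  have e6 := pow_le_pow_left₀ (sq_nonneg ‖y‖) e2 2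
  have e7 : (‖y‖ ^ 2) ^ 2 ≤ ‖Φ 1‖ * ‖y‖ ^ 2 * (⟪x, Φ (star B * B) x⟫_ℂ).re :=
    e6.trans (e3.trans (mul_le_mul_of_nonneg_right e4 e5))
  rcases eq_or_ne (‖y‖ ^ 2) 0 with h0 | h0
  · rw [h0]; positivity
  · have hpos : 0 < ‖y‖ ^ 2 := lt_of_le_of_ne (sq_nonneg _) h0.symm
    refine le_of_mul_le_mul_left ?_ hpos
    nlinarith

end IsTwoPositive

variable {Φ : (H →L[ℂ] H) →ₗ[ℂ] (H →L[ℂ] H)} {Φs : TraceClass H → TraceClass H}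

theorem IsPredual.inner_eq_trace (h : IsPredual Φ Φs) (X : H →L[ℂ] H) (φ : H) :
    ⟪φ, Φ X φ⟫_ℂ = trace (X * (Φs (pure φ)).1) := by
  rw [← h, pure, trace_mul_rankOne]

-- Tested on the rank-one operator of `x`, the duality gives `⟨x, Φ_*(|φ⟩⟨φ|) x⟩ = ⟨φ, Φ(|x⟩⟨x|) φ⟩
-- ≥ 0`.
open scoped ComplexOrder in
theorem IsPredual.nonneg_pure (h : IsPredual Φ Φs) (hΦ : IsTwoPositive Φ) (φ : H) :
    0 ≤ (Φs (pure φ)).1 := by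
  have h1 : ∀ x : H, 0 ≤ ⟪(Φs (pure φ)).1 x, x⟫_ℂ := fun x => by
    have h2 := h.inner_eq_trace (InnerProductSpace.rankOne ℂ x x) φ
    rw [trace_rankOne_mul] at h2
    have h3 := ((ContinuousLinearMap.nonneg_iff_isPositive _).1
      (hΦ.map_nonneg (pure_nonneg x))).inner_nonneg_right φ
    change 0 ≤ ⟪φ, Φ (InnerProductSpace.rankOne ℂ x x) φ⟫_ℂ at h3
    rw [h2] at h3
    rw [Complex.le_def] at h3
    rw [← inner_conj_symm, Complex.le_def, Complex.conj_re, Complex.conj_im, ← h3.2]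
    exact ⟨h3.1, by simp⟩
  rw [ContinuousLinearMap.nonneg_iff_isPositive, ContinuousLinearMap.isPositive_iff_complex]
  intro x
  have h2 := Complex.le_def.1 (h1 x)
  exact ⟨Complex.ext rfl (by simpa using h2.2), h2.1⟩

end EnergyNorm

namespace EnergyNorm

variable {H : Type*} [NormedAddCommGroup H] [InnerProductSpace ℂ H] [CompleteSpace H]

/-! ### The `E`-norms and the form bounds they encode. -/

section ENorm

variable {G : H →ₗ.[ℂ] H}

theorem eNorm_le_ofReal {e r : ℝ} {A : SqrtDomOp G}
    (h : ∀ φ : (sqrtOp G).domain, ‖(φ : H)‖ = 1 → ‖sqrtOp G φ‖ ^ 2 ≤ e → ‖A φ‖ ≤ r) :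
    eNorm G e A ≤ ENNReal.ofReal r := by
  refine iSup_le fun φ => iSup_le fun h1 => iSup_le fun h2 => ?_
  rw [← ofReal_norm]
  exact ENNReal.ofReal_le_ofReal (h φ h1 h2)

theorem eNorm_lt_top (e : ℝ) (A : InfOp G) : eNorm G e A.1 < ⊤ := by
  obtain ⟨⟨a, b⟩, -, -, h⟩ := A.2.1
  simp only at h
  refine lt_of_le_of_lt (eNorm_le_ofReal (r := √(a ^ 2 + b ^ 2 * e)) fun φ h1 h2 => ?_)
    ENNReal.ofReal_lt_top
  refine Real.le_sqrt_of_sq_le ((h φ).trans ?_)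
  rw [h1]
  have := mul_le_mul_of_nonneg_left h2 (sq_nonneg b)
  linarith

theorem norm_le_toReal_eNorm {e : ℝ} (A : InfOp G) {φ : (sqrtOp G).domain}
    (h1 : ‖(φ : H)‖ = 1) (h2 : ‖sqrtOp G φ‖ ^ 2 ≤ e) :
    ‖A.1 φ‖ ≤ (eNorm G e A.1).toReal := by
  have h : ‖A.1 φ‖ₑ ≤ eNorm G e A.1 :=
    le_iSup_of_le φ (le_iSup_of_le h1 (le_iSup_of_le h2 le_rfl))
  have := ENNReal.toReal_mono (eNorm_lt_top e A).ne h
  simpa using this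

/-- The S-lemma on `V = D(√G)`, with the inclusion as `J`; `InfZero G` supplies its low-energy
vectors. -/
theorem exists_dominating_of_norm_le (hG : IsPositiveOp G) (hG0 : InfZero G) {e F : ℝ}
    (he : 0 < e) {A : SqrtDomOp G}
    (h : ∀ φ : (sqrtOp G).domain, ‖(φ : H)‖ = 1 → ‖sqrtOp G φ‖ ^ 2 ≤ e → ‖A φ‖ ^ 2 ≤ F) :
    ∃ α κ : ℝ, 0 ≤ α ∧ 0 ≤ κ ∧ α + κ * e = F ∧ ∀ φ : (sqrtOp G).domain,
      ‖A φ‖ ^ 2 ≤ α * ‖(φ : H)‖ ^ 2 + κ * ‖sqrtOp G φ‖ ^ 2 :=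
  exists_dominating_form (sqrtOp G).domain.subtype (sqrtOp G).toFun A
    Subtype.val_injective (fun _ hε => hG.exists_low_energy hG0 hε) he h

theorem exists_dominating (hG : IsPositiveOp G) (hG0 : InfZero G) {e : ℝ} (he : 0 < e)
    (A : InfOp G) :
    ∃ α κ : ℝ, 0 ≤ α ∧ 0 ≤ κ ∧ α + κ * e = (eNorm G e A.1).toReal ^ 2 ∧
      ∀ φ : (sqrtOp G).domain,
        ‖A.1 φ‖ ^ 2 ≤ α * ‖(φ : H)‖ ^ 2 + κ * ‖sqrtOp G φ‖ ^ 2 :=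
  exists_dominating_of_norm_le hG hG0 he fun _ h1 h2 =>
    pow_le_pow_left₀ (norm_nonneg _) (norm_le_toReal_eNorm A h1 h2) 2

theorem eq_zero_of_eNorm_eq_zero (hG : IsPositiveOp G) (hG0 : InfZero G) {e : ℝ} (he : 0 < e)
    {A : InfOp G} (h : eNorm G e A.1 = 0) : A = 0 := by
  obtain ⟨α, κ, hα, hκ, hs, hA⟩ := exists_dominating hG hG0 he A
  rw [h, ENNReal.toReal_zero, zero_pow two_ne_zero] at hs
  have hκe := mul_nonneg hκ he.le
  have h1 : α = 0 := by linarith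
  have h2 : κ = 0 := by
    have : κ * e = 0 := by linarith
    exact (mul_eq_zero.1 this).resolve_right he.ne'
  refine Subtype.ext (LinearMap.ext fun φ => ?_)
  have := hA φ
  rw [h1, h2, zero_mul, zero_mul, add_zero] at this
  exact norm_eq_zero.1 ((pow_eq_zero_iff two_ne_zero).1 (le_antisymm this (sq_nonneg _)))

/-- The energy norms for different energies are equivalent. -/
theorem eNorm_le_mul_eNorm (hG : IsPositiveOp G) (hG0 : InfZero G) {E y : ℝ} (hE : 0 < E)
    (A : InfOp G) :
    eNorm G y A.1 ≤ ENNReal.ofReal (√(max 1 (y / E))) * eNorm G E A.1 := by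
  obtain ⟨α, κ, hα, hκ, hs, hA⟩ := exists_dominating hG hG0 hE A
  rw [← ENNReal.ofReal_toReal (eNorm_lt_top E A).ne,
    ← ENNReal.ofReal_mul (Real.sqrt_nonneg _)]
  refine eNorm_le_ofReal fun φ h1 h2 => ?_
  refine le_of_sq_le_sq ?_ (by positivity)
  rw [mul_pow, Real.sq_sqrt (by positivity), ← hs]
  refine (hA φ).trans ?_
  rw [h1]
  -- Together these give `α + κ y ≤ max(1, y / E) (α + κ E)`.
  have k1 : α ≤ max 1 (y / E) * α := le_mul_of_one_le_left hα (le_max_left _ _)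
  have k2 : y ≤ max 1 (y / E) * E := by
    rw [← div_le_iff₀ hE]
    exact le_max_right _ _
  have k3 := mul_le_mul_of_nonneg_left (h2.trans k2) hκ
  linarith

end ENorm

/-! ### The truncations `A P_n`. -/

section Truncation

variable {G : H →ₗ.[ℂ] H}

theorem exists_norm_apply_specProj_le (hG : IsPositiveOp G) (n : ℕ) (A : InfOp G) :
    ∃ C, ∀ x, ‖A.1 ⟨specProj G n x, hG.specProj_mem n x⟩‖ ≤ C * ‖x‖ := by
  obtain ⟨⟨a, b⟩, -, -, h⟩ := A.2.1
  simp only at h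
  refine ⟨√(a ^ 2 + b ^ 2 * ‖cutoff G n‖), fun x => ?_⟩
  refine le_of_sq_le_sq ?_ (by positivity)
  refine (h _).trans ?_
  rw [hG.norm_sqrtOp_specProj_sq, mul_pow, Real.sq_sqrt (by positivity)]
  have h1 : (⟪x, cutoff G n x⟫_ℂ).re ≤ ‖cutoff G n‖ * ‖x‖ ^ 2 := by
    refine (re_inner_le_norm (𝕜 := ℂ) _ _).trans ?_
    have := mul_le_mul_of_nonneg_left ((cutoff G n).le_opNorm x) (norm_nonneg x)
    linarith
  have h2 := pow_le_pow_left₀ (norm_nonneg _) (norm_specProj_apply_le G n x) 2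
  have h3 := mul_le_mul_of_nonneg_left h1 (sq_nonneg b)
  have h4 := mul_le_mul_of_nonneg_left h2 (sq_nonneg a)
  simp only
  linarith

/-- The bounded operators `A P_n`. -/
noncomputable def trunc (hG : IsPositiveOp G) (n : ℕ) : InfOp G →ₗ[ℂ] (H →L[ℂ] H) where
  toFun A := (A.1 ∘ₗ (specProj G n).toLinearMap.codRestrict (sqrtOp G).domain
    (hG.specProj_mem n)).mkContinuousOfExistsBound (exists_norm_apply_specProj_le hG n A)
  map_add' _ _ := rfl
  map_smul' _ _ := rfl

theorem trunc_apply (hG : IsPositiveOp G) (n : ℕ) (A : InfOp G) (x : H) :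
    trunc hG n A x = A.1 ⟨specProj G n x, hG.specProj_mem n x⟩ := rfl

theorem norm_trunc_apply_sq_le (hG : IsPositiveOp G) (n : ℕ) {A : InfOp G} {α κ : ℝ}
    (hα : 0 ≤ α) (h : ∀ φ : (sqrtOp G).domain,
      ‖A.1 φ‖ ^ 2 ≤ α * ‖(φ : H)‖ ^ 2 + κ * ‖sqrtOp G φ‖ ^ 2) (x : H) :
    ‖trunc hG n A x‖ ^ 2 ≤ α * ‖x‖ ^ 2 + κ * (⟪x, cutoff G n x⟫_ℂ).re := by
  rw [trunc_apply]
  refine (h _).trans ?_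
  rw [hG.norm_sqrtOp_specProj_sq]
  have h2 := pow_le_pow_left₀ (norm_nonneg _) (norm_specProj_apply_le G n x) 2
  have h4 := mul_le_mul_of_nonneg_left h2 hα
  simp only
  linarith

/-- Relative bound zero enters here. A pair `(a, b)` with `b² ≤ δ / 2` is applied to `(1 - P_m) φ`:
the `b`-term is small at once, and the `a`-term is at most `(a² / m) ‖√G φ‖²`, so `m` can be chosen
after `a`. -/
theorem norm_sub_trunc_sq_le (hG : IsPositiveOp G) (A : InfOp G) {δ : ℝ} (hδ : 0 < δ) :
    ∃ N, ∀ m ≥ N, ∀ φ : (sqrtOp G).domain,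
      ‖A.1 φ - trunc hG m A φ‖ ^ 2 ≤ δ * ‖sqrtOp G φ‖ ^ 2 := by
  obtain ⟨a, b, ⟨-, hb, h⟩, hbδ⟩ := isInfinitesimal_iff.1 A.2 (√(δ / 2)) (by positivity)
  simp only at h hb
  have hb2 : b ^ 2 ≤ δ / 2 := by
    rw [← Real.sq_sqrt (half_pos hδ).le]
    exact pow_le_pow_left₀ hb hbδ.le 2
  obtain ⟨N, hN⟩ := exists_nat_gt (a ^ 2 / (δ / 2))
  have hN0 : (0 : ℝ) < N := lt_of_le_of_lt (by positivity) hN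
  refine ⟨N, fun m hm φ => ?_⟩
  have hm' : (N : ℝ) ≤ m := by exact_mod_cast hm
  have e : A.1 φ - trunc hG m A φ = A.1 ⟨_, hG.one_sub_specProj_mem m φ⟩ := by
    rw [trunc_apply, ← map_sub]
    rfl
  rw [e]
  refine (h _).trans ?_
  have h1 := hG.norm_one_sub_specProj_sq_le m φ
  have h2 := pow_le_pow_left₀ (norm_nonneg _) (hG.norm_sqrtOp_one_sub_specProj_le m φ) 2
  have h3 : a ^ 2 * ‖(1 - specProj G m) (φ : H)‖ ^ 2 ≤ δ / 2 * ‖sqrtOp G φ‖ ^ 2 := by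
    rw [div_lt_iff₀ (half_pos hδ)] at hN
    calc a ^ 2 * ‖(1 - specProj G m) (φ : H)‖ ^ 2
        ≤ (m * (δ / 2)) * ‖(1 - specProj G m) (φ : H)‖ ^ 2 := by
          refine mul_le_mul_of_nonneg_right (hN.le.trans ?_) (sq_nonneg _)
          exact mul_le_mul_of_nonneg_right hm' (half_pos hδ).le
      _ = δ / 2 * (m * ‖(1 - specProj G m) (φ : H)‖ ^ 2) := by ring
      _ ≤ _ := mul_le_mul_of_nonneg_left h1 (half_pos hδ).le
  have h4 := mul_le_mul hb2 h2 (sq_nonneg _) (half_pos hδ).le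
  simp only
  linarith

/-- Bounded operators are thus dense in the `E`-norm. -/
theorem exists_eNorm_sub_trunc_le (hG : IsPositiveOp G) (A : InfOp G) (E : ℝ) {ε : ℝ}
    (hε : 0 < ε) : ∃ n, eNorm G E (A - ofBounded G (trunc hG n A)).1 ≤ ENNReal.ofReal ε := by
  obtain ⟨N, hN⟩ := norm_sub_trunc_sq_le hG A (δ := ε ^ 2 / (|E| + 1)) (by positivity)
  refine ⟨N, eNorm_le_ofReal fun φ _ h2 => ?_⟩
  refine le_of_sq_le_sq ((hN N le_rfl φ).trans ?_) hε.le
  rw [div_mul_eq_mul_div, div_le_iff₀ (by positivity)]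
  refine mul_le_mul_of_nonneg_left ?_ (sq_nonneg _)
  have := le_abs_self E
  linarith

theorem trunc_mul_specProj_comm (hG : IsPositiveOp G) (m n : ℕ) (A : InfOp G) :
    trunc hG m A * specProj G n = trunc hG n A * specProj G m := by
  ext x
  change A.1 _ = A.1 _
  congr 1
  refine Subtype.ext ?_
  exact congrArg (fun T : H →L[ℂ] H => T x) (hG.commute_specProj_specProj m n).eq

end Truncation

end EnergyNorm

/-! ### Construction of the extension and its norm estimate. -/

namespace EnergyNorm

variable {H : Type*} [NormedAddCommGroup H] [InnerProductSpace ℂ H] [CompleteSpace H]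
  {G : H →ₗ.[ℂ] H} {Φ : (H →L[ℂ] H) →ₗ[ℂ] (H →L[ℂ] H)} {Φs : TraceClass H → TraceClass H}

theorem re_inner_map_one_le (hΦ1 : Φ 1 ≤ 1) (x : H) : (⟪x, Φ 1 x⟫_ℂ).re ≤ ‖x‖ ^ 2 :=
  (re_inner_mono hΦ1 x).trans (inner_self_eq_norm_sq (𝕜 := ℂ) x).le

/-- The hypothesis says `B*B ≤ α + κ T`; apply the monotone map `Φ`, use `Φ(1) ≤ 1`, and conclude by
Kadison's inequality. -/
theorem IsTwoPositive.norm_map_apply_sq_le_of_dominated (hΦ : IsTwoPositive Φ) (hΦ1 : Φ 1 ≤ 1)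
    {B T : H →L[ℂ] H} (hT : 0 ≤ T) {α κ : ℝ} (hα : 0 ≤ α)
    (h : ∀ x, ‖B x‖ ^ 2 ≤ α * ‖x‖ ^ 2 + κ * (⟪x, T x⟫_ℂ).re) (φ : H) :
    ‖Φ B φ‖ ^ 2 ≤ ‖Φ 1‖ * (α * ‖φ‖ ^ 2 + κ * (⟪φ, Φ T φ⟫_ℂ).re) := by
  have hform : ∀ (S U : H →L[ℂ] H) (x : H), (⟪x, ((α : ℂ) • S + (κ : ℂ) • U) x⟫_ℂ).re =
      α * (⟪x, S x⟫_ℂ).re + κ * (⟪x, U x⟫_ℂ).re := fun S U x => by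
    change (⟪x, (α : ℂ) • S x + (κ : ℂ) • U x⟫_ℂ).re = _
    rw [inner_add_right, inner_smul_right, inner_smul_right, Complex.add_re,
      Complex.re_ofReal_mul, Complex.re_ofReal_mul]
  have hsa : ∀ r : ℝ, IsSelfAdjoint (r : ℂ) := fun r => Complex.conj_ofReal r
  have hle : star B * B ≤ (α : ℂ) • (1 : H →L[ℂ] H) + (κ : ℂ) • T := by
    refine le_of_re_inner (IsSelfAdjoint.star_mul_self B)
      (((hsa α).smul (IsSelfAdjoint.one _)).add ((hsa κ).smul hT.isSelfAdjoint)) fun x => ?_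
    rw [hform, mul_apply_eq_comp, ContinuousLinearMap.star_eq_adjoint,
      ContinuousLinearMap.adjoint_inner_right]
    have e1 : (⟪B x, B x⟫_ℂ).re = ‖B x‖ ^ 2 := inner_self_eq_norm_sq (𝕜 := ℂ) _
    have e2 : (⟪x, (1 : H →L[ℂ] H) x⟫_ℂ).re = ‖x‖ ^ 2 := inner_self_eq_norm_sq (𝕜 := ℂ) _
    rw [e1, e2]
    exact h x
  have h1 := re_inner_mono (hΦ.mono hle) φ
  rw [map_add, map_smul, map_smul, hform] at h1
  refine (hΦ.norm_map_apply_sq_le B φ).trans (mul_le_mul_of_nonneg_left ?_ (norm_nonneg _))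
  have h2 := mul_le_mul_of_nonneg_left (re_inner_map_one_le hΦ1 φ) hα
  linarith

/-- This replaces the S-lemma when `Y = 0`. For `σ = Φ_*(|φ⟩⟨φ|)` the condition `Tr T σ = 0` puts
every `√σ e_i` in the kernel of `T`, where `B` is bounded by `r`; summing gives `Tr B*B σ ≤ r² Tr
σ`. -/
theorem IsTwoPositive.norm_map_apply_sq_le_of_ker (hΦ : IsTwoPositive Φ) (hΦ1 : Φ 1 ≤ 1)
    (hΦs : IsPredual Φ Φs) {B T : H →L[ℂ] H} (hT : 0 ≤ T) {r : ℝ}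
    (h : ∀ x, T x = 0 → ‖B x‖ ≤ r * ‖x‖) {φ : H} (hφ : (⟪φ, Φ T φ⟫_ℂ).re = 0) :
    ‖Φ B φ‖ ^ 2 ≤ ‖Φ 1‖ * (r ^ 2 * ‖φ‖ ^ 2) := by
  refine (hΦ.norm_map_apply_sq_le B φ).trans (mul_le_mul_of_nonneg_left ?_ (norm_nonneg _))
  refine le_trans ?_ (mul_le_mul_of_nonneg_left (re_inner_map_one_le hΦ1 φ) (sq_nonneg r))
  have h0 := hΦs.nonneg_pure hΦ φ
  have h2 := (Φs (pure φ)).2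
  rw [hΦs.inner_eq_trace] at hφ
  rw [hΦs.inner_eq_trace, hΦs.inner_eq_trace]
  refine hasSum_le (fun i => ?_) (Complex.hasSum_re (hasSum_trace h0 h2 _))
    ((Complex.hasSum_re (hasSum_trace h0 h2 1)).mul_left (r ^ 2))
  have h3 := h _ (apply_sqrt_eq_zero_of_trace h0 h2 hT hφ i)
  generalize CFC.sqrt (Φs (pure φ)).1 (basis H i) = z at h3
  rw [mul_apply_eq_comp, ContinuousLinearMap.star_eq_adjoint,
    ContinuousLinearMap.adjoint_inner_right]
  have e1 : (⟪B z, B z⟫_ℂ).re = ‖B z‖ ^ 2 := inner_self_eq_norm_sq (𝕜 := ℂ) _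
  have e2 : (⟪z, (1 : H →L[ℂ] H) z⟫_ℂ).re = ‖z‖ ^ 2 := inner_self_eq_norm_sq (𝕜 := ℂ) _
  rw [e1, e2, ← mul_pow]
  exact pow_le_pow_left₀ (norm_nonneg _) h3 2

theorem isState_pure {φ : H} (hφ : ‖φ‖ = 1) : IsState (pure φ) := by
  refine ⟨pure_nonneg φ, ?_⟩
  have h := trace_mul_rankOne (1 : H →L[ℂ] H) φ φ
  rw [one_mul] at h
  refine h.trans ?_
  rw [one_apply_eq_self, inner_self_eq_norm_sq_to_K, hφ]
  simp

theorem re_inner_map_cutoff_le (hG : IsPositiveOp G) (hΦs : IsPredual Φ Φs) {E : ℝ}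
    (hY : Y G Φs E < ⊤) (n : ℕ) {φ : (sqrtOp G).domain} (h1 : ‖(φ : H)‖ = 1)
    (h2 : ‖sqrtOp G φ‖ ^ 2 ≤ E) :
    (⟪(φ : H), Φ (cutoff G n) φ⟫_ℂ).re ≤ (Y G Φs E).toReal := by
  have hE : trG G (pure (φ : H)) ≤ ENNReal.ofReal E := by
    refine iSup_le fun m => ENNReal.ofReal_le_ofReal ?_
    rw [pure, trace_mul_rankOne]
    exact (hG.re_inner_cutoff_le m φ).trans h2
  have h3 : trG G (Φs (pure (φ : H))) ≤ Y G Φs E :=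
    le_iSup_of_le (pure (φ : H)) (le_iSup_of_le (isState_pure h1) (le_iSup_of_le hE le_rfl))
  rw [hΦs.inner_eq_trace, ← ENNReal.ofReal_le_iff_le_toReal hY.ne]
  exact (le_iSup (fun n => ENNReal.ofReal (trace (cutoff G n * (Φs (pure (φ : H))).1)).re)
    n).trans h3

/-- The bound by `Y` is known only for unit vectors of energy at most `E`. The S-lemma for `√Φ(G
P_n)` spreads it over `D(√G)`, uniformly in `n`: from `α + κ E = Y` follow `α ≤ Y` and `κ ≤ Y / E`.
-/
theorem re_inner_map_cutoff_le_form (hG : IsPositiveOp G) (hG0 : InfZero G)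
    (hΦ : IsTwoPositive Φ) (hΦs : IsPredual Φ Φs) {E : ℝ} (hE : 0 < E) (hY : Y G Φs E < ⊤)
    (n : ℕ) (φ : (sqrtOp G).domain) :
    (⟪(φ : H), Φ (cutoff G n) φ⟫_ℂ).re ≤ (Y G Φs E).toReal * ‖(φ : H)‖ ^ 2 +
      (Y G Φs E).toReal / E * ‖sqrtOp G φ‖ ^ 2 := by
  have h0 := hΦ.map_nonneg (hG.cutoff_nonneg n)
  obtain ⟨α, κ, hα, hκ, hs, hA⟩ := exists_dominating_of_norm_le hG hG0 hE
    (A := (CFC.sqrt (Φ (cutoff G n))).toLinearMap.domRestrict (sqrtOp G).domain)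
    (F := (Y G Φs E).toReal) fun ψ h1 h2 => by
      change ‖CFC.sqrt (Φ (cutoff G n)) (ψ : H)‖ ^ 2 ≤ _
      rw [norm_sqrt_apply_sq h0]
      exact re_inner_map_cutoff_le hG hΦs hY n h1 h2
  have h1 : ‖CFC.sqrt (Φ (cutoff G n)) (φ : H)‖ ^ 2 ≤ _ := hA φ
  rw [norm_sqrt_apply_sq h0] at h1
  have hκE := mul_nonneg hκ hE.le
  refine h1.trans (add_le_add ?_ ?_)
  · exact mul_le_mul_of_nonneg_right (by linarith) (sq_nonneg _)
  · refine mul_le_mul_of_nonneg_right ?_ (sq_nonneg _)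
    rw [le_div_iff₀ hE]
    linarith

theorem cauchySeq_map_trunc (hG : IsPositiveOp G) (hG0 : InfZero G)
    (hΦ : IsTwoPositive Φ) (hΦ1 : Φ 1 ≤ 1) (hΦs : IsPredual Φ Φs) {E : ℝ} (hE : 0 < E)
    (hY : Y G Φs E < ⊤) (A : InfOp G) (φ : (sqrtOp G).domain) :
    CauchySeq fun n => Φ (trunc hG n A) (φ : H) := by
  set M := (Y G Φs E).toReal * ‖(φ : H)‖ ^ 2 +
      (Y G Φs E).toReal / E * ‖sqrtOp G φ‖ ^ 2 with hM
  have hM0 : 0 ≤ M := by positivity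
  -- The operator is `(A - A P_m) P_n`, whose square is dominated by `δ G P_n`. The bound is uniform
  -- in `n`.
  have htail : ∀ δ > 0, ∃ N, ∀ m ≥ N, ∀ n,
      ‖Φ (trunc hG n A - trunc hG m A * specProj G n) (φ : H)‖ ^ 2 ≤ ‖Φ 1‖ * (δ * M) := by
    intro δ hδ
    obtain ⟨N, hN⟩ := norm_sub_trunc_sq_le hG A hδ
    refine ⟨N, fun m hm n => ?_⟩
    have h1 := hΦ.norm_map_apply_sq_le_of_dominated hΦ1
      (B := trunc hG n A - trunc hG m A * specProj G n) (hG.cutoff_nonneg n) (α := 0) (κ := δ)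
      le_rfl (fun x => by
        have h2 := hN m hm ⟨specProj G n x, hG.specProj_mem n x⟩
        rw [hG.norm_sqrtOp_specProj_sq] at h2
        rw [zero_mul, zero_add]
        exact h2) φ
    refine h1.trans (mul_le_mul_of_nonneg_left ?_ (norm_nonneg _))
    rw [zero_mul, zero_add]
    exact mul_le_mul_of_nonneg_left
      (re_inner_map_cutoff_le_form hG hG0 hΦ hΦs hE hY n φ) hδ.le
  refine Metric.cauchySeq_iff.2 fun ε hε => ?_
  have hD : 0 < ‖Φ 1‖ * M + 1 := by positivity
  obtain ⟨N, hN⟩ := htail ((ε / 3) ^ 2 / (‖Φ 1‖ * M + 1)) (by positivity)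
  have hN' : ∀ m ≥ N, ∀ n,
      ‖Φ (trunc hG n A - trunc hG m A * specProj G n) (φ : H)‖ ≤ ε / 3 := fun m hm n => by
    refine le_of_sq_le_sq ((hN m hm n).trans ?_) (by positivity)
    have e : ‖Φ 1‖ * ((ε / 3) ^ 2 / (‖Φ 1‖ * M + 1) * M) =
        (ε / 3) ^ 2 * ((‖Φ 1‖ * M) / (‖Φ 1‖ * M + 1)) := by ring
    rw [e]
    refine mul_le_of_le_one_right (sq_nonneg _) ((div_le_one hD).2 ?_)
    linarith
  refine ⟨N, fun m hm n hn => ?_⟩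
  -- The common part `A P_n P_m = A P_m P_n` cancels and leaves two tails of the above kind.
  have e : trunc hG m A - trunc hG n A = (trunc hG m A - trunc hG n A * specProj G m) -
      (trunc hG n A - trunc hG m A * specProj G n) := by
    rw [trunc_mul_specProj_comm hG m n]
    abel
  rw [dist_eq_norm]
  have e2 : Φ (trunc hG m A) (φ : H) - Φ (trunc hG n A) (φ : H) =
      Φ (trunc hG m A - trunc hG n A * specProj G m) (φ : H) -
        Φ (trunc hG n A - trunc hG m A * specProj G n) (φ : H) := by
    rw [← sub_apply, ← map_sub, e, map_sub, sub_apply]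
  rw [e2]
  refine (norm_sub_le _ _).trans_lt ?_
  have h1 := hN' n hn m
  have h2 := hN' m hm n
  linarith

theorem norm_map_trunc_sq_le (hG : IsPositiveOp G) (hΦ : IsTwoPositive Φ) (hΦ1 : Φ 1 ≤ 1)
    {A : InfOp G} {α κ : ℝ} (hα : 0 ≤ α) (hκ : 0 ≤ κ)
    (h : ∀ φ : (sqrtOp G).domain,
      ‖A.1 φ‖ ^ 2 ≤ α * ‖(φ : H)‖ ^ 2 + κ * ‖sqrtOp G φ‖ ^ 2) (n : ℕ) (φ : H) {M : ℝ}
    (hM : (⟪φ, Φ (cutoff G n) φ⟫_ℂ).re ≤ M) :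
    ‖Φ (trunc hG n A) φ‖ ^ 2 ≤ ‖Φ 1‖ * (α * ‖φ‖ ^ 2 + κ * M) := by
  refine (hΦ.norm_map_apply_sq_le_of_dominated hΦ1 (hG.cutoff_nonneg n) hα
    (norm_trunc_apply_sq_le hG n hα h) φ).trans (mul_le_mul_of_nonneg_left ?_ (norm_nonneg _))
  have := mul_le_mul_of_nonneg_left hM hκ
  linarith

/-- The limit of `Φ (A P_n)` on `D(√G)`, as a linear operator on `B⁰_G(H)`. -/
theorem exists_extension (hG : IsPositiveOp G) (hG0 : InfZero G)
    (hΦ : IsTwoPositive Φ) (hΦ1 : Φ 1 ≤ 1) (hΦs : IsPredual Φ Φs) {E : ℝ} (hE : 0 < E)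
    (hY : Y G Φs E < ⊤) :
    ∃ ΦG : InfOp G →ₗ[ℂ] InfOp G, ∀ (A : InfOp G) (φ : (sqrtOp G).domain),
      Filter.Tendsto (fun n => Φ (trunc hG n A) (φ : H)) Filter.atTop (nhds ((ΦG A).1 φ)) := by
  have hlim := fun A φ => cauchySeq_tendsto_of_complete
    (cauchySeq_map_trunc hG hG0 hΦ hΦ1 hΦs hE hY A φ)
  choose L hL using hlim
  let L1 : InfOp G → SqrtDomOp G := fun A =>
    { toFun := L A
      map_add' := fun φ ψ => by
        refine tendsto_nhds_unique (hL A (φ + ψ)) (((hL A φ).add (hL A ψ)).congr fun n => ?_)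
        exact (map_add _ _ _).symm
      map_smul' := fun z φ => by
        refine tendsto_nhds_unique (hL A (z • φ)) (((hL A φ).const_smul z).congr fun n => ?_)
        exact (map_smul _ _ _).symm }
  have hmem : ∀ A, IsInfinitesimal G (L1 A) := by
    intro A
    refine isInfinitesimal_iff.2 fun ε hε => ?_
    set y := (Y G Φs E).toReal with hy
    have hy0 : 0 ≤ y := ENNReal.toReal_nonneg
    -- The limit satisfies `‖Φ_G(A) φ‖² ≤ ‖Φ(1)‖ (a² ‖φ‖² + b² (y ‖φ‖² + (y / E) ‖√G φ‖²))`, so `b`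
    -- is multiplied by `c` and can still be made arbitrarily small.
    set c := √(‖Φ 1‖ * (y / E)) with hc
    have hc2 : c ^ 2 = ‖Φ 1‖ * (y / E) := Real.sq_sqrt (by positivity)
    have hc0 : 0 ≤ c := Real.sqrt_nonneg _
    obtain ⟨a, b, ⟨ha, hb, h⟩, hbε⟩ := isInfinitesimal_iff.1 A.2 (ε / (c + 1)) (by positivity)
    simp only at ha hb h
    refine ⟨√(‖Φ 1‖ * (a ^ 2 + b ^ 2 * y)), c * b, ⟨by positivity, by positivity, fun φ => ?_⟩, ?_⟩
    · change ‖L A φ‖ ^ 2 ≤ _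
      refine le_of_tendsto ((hL A φ).norm.pow 2) (Filter.Eventually.of_forall fun n => ?_)
      refine (norm_map_trunc_sq_le hG hΦ hΦ1 (sq_nonneg a) (sq_nonneg b) h n φ
        (re_inner_map_cutoff_le_form hG hG0 hΦ hΦs hE hY n φ)).trans (le_of_eq ?_)
      simp only
      rw [Real.sq_sqrt (by positivity), mul_pow, hc2]
      ring
    · rw [lt_div_iff₀ (by positivity)] at hbε
      linarith
  refine ⟨{ toFun := fun A => ⟨L1 A, hmem A⟩, map_add' := fun A B => ?_, map_smul' := fun z A => ?_ },
    fun A φ => hL A φ⟩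
  · refine Subtype.ext (LinearMap.ext fun φ => ?_)
    refine tendsto_nhds_unique (hL (A + B) φ) (((hL A φ).add (hL B φ)).congr fun n => ?_)
    rw [map_add, map_add]
    rfl
  · refine Subtype.ext (LinearMap.ext fun φ => ?_)
    refine tendsto_nhds_unique (hL (z • A) φ) (((hL A φ).const_smul z).congr fun n => ?_)
    rw [map_smul, map_smul]
    rfl

/-- The error is `Φ(B (1 - P_n)) φ`. As `(1 - P_n) B*B (1 - P_n) ≤ ‖B‖² (1 - P_n)`, Kadison's
inequality reduces it to `⟨φ, Φ(1 - P_n) φ⟩`, which tends to zero because `Φ` has a predual. -/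
theorem tendsto_map_mul_specProj (hG : IsPositiveOp G) (hΦ : IsTwoPositive Φ)
    (hΦ1 : Φ 1 ≤ 1) (hΦs : IsPredual Φ Φs) (B : H →L[ℂ] H) (φ : H) :
    Filter.Tendsto (fun n => Φ (B * specProj G n) φ) Filter.atTop (nhds (Φ B φ)) := by
  have h0 := hΦs.nonneg_pure hΦ φ
  have ht : Filter.Tendsto (fun n => (⟪φ, Φ (1 - specProj G n) φ⟫_ℂ).re) Filter.atTop
      (nhds 0) := by
    have := tendsto_trace_mul h0 (Φs (pure φ)).2 (X := fun n => 1 - specProj G n)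
      (norm_one_sub_specProj_apply_le G) hG.tendsto_one_sub_specProj
    simp_rw [hΦs.inner_eq_trace]
    exact (Complex.continuous_re.tendsto 0).comp this
  have hb : ∀ n, ‖Φ (B * (1 - specProj G n)) φ‖ ^ 2 ≤
      ‖Φ 1‖ * (‖B‖ ^ 2 * (⟪φ, Φ (1 - specProj G n) φ⟫_ℂ).re) := fun n => by
    have hQs : IsSelfAdjoint (1 - specProj G n) :=
      (IsSelfAdjoint.one _).sub (specProj_isSelfAdjoint G n)
    have hQQ : (1 - specProj G n) * (1 - specProj G n) = 1 - specProj G n := by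
      rw [mul_sub, sub_mul, sub_mul, specProj_mul_self]
      simp
    have hQ : ∀ x, (⟪x, (1 - specProj G n) x⟫_ℂ).re = ‖(1 - specProj G n) x‖ ^ 2 := fun x => by
      conv_lhs => rw [← hQQ]
      rw [mul_apply_eq_comp, ← IsSelfAdjoint.inner_map hQs]
      exact inner_self_eq_norm_sq (𝕜 := ℂ) _
    have hQ0 : 0 ≤ 1 - specProj G n :=
      le_of_re_inner (IsSelfAdjoint.zero _) hQs fun x => by rw [hQ]; simp
    have h := hΦ.norm_map_apply_sq_le_of_dominated hΦ1 (B := B * (1 - specProj G n)) hQ0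
      (α := 0) (κ := ‖B‖ ^ 2) le_rfl (fun x => by
        rw [hQ, zero_mul, zero_add, ← mul_pow]
        exact pow_le_pow_left₀ (norm_nonneg _) (B.le_opNorm _) 2) φ
    rwa [zero_mul, zero_add] at h
  have h1 : Filter.Tendsto (fun n => ‖Φ (B * (1 - specProj G n)) φ‖ ^ 2) Filter.atTop
      (nhds 0) := by
    refine squeeze_zero (fun n => sq_nonneg _) hb ?_
    simpa using (ht.const_mul (‖B‖ ^ 2)).const_mul ‖Φ 1‖
  have h2 : Filter.Tendsto (fun n => ‖Φ (B * (1 - specProj G n)) φ‖) Filter.atTop (nhds 0) := by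
    simpa using h1.sqrt
  have h3 := (tendsto_const_nhds (x := Φ B φ)).sub (tendsto_zero_iff_norm_tendsto_zero.2 h2)
  rw [sub_zero] at h3
  refine h3.congr fun n => ?_
  rw [← sub_apply, ← map_sub, mul_sub, mul_one, sub_sub_cancel]

/-- The S-lemma is used at energy `Y`, not `E`, so that `α + κ Y` is exactly the square of `‖A‖_Y`.
-/
theorem norm_extension_apply_le (hG : IsPositiveOp G) (hG0 : InfZero G)
    (hΦ : IsTwoPositive Φ) (hΦ1 : Φ 1 ≤ 1) (hΦs : IsPredual Φ Φs) {E : ℝ}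
    (hY : Y G Φs E < ⊤) (n : ℕ) (A : InfOp G) {φ : (sqrtOp G).domain}
    (h1 : ‖(φ : H)‖ = 1) (h2 : ‖sqrtOp G φ‖ ^ 2 ≤ E) :
    ‖Φ (trunc hG n A) (φ : H)‖ ≤ √‖Φ 1‖ * (eNorm G (Y G Φs E).toReal A.1).toReal := by
  have hb := re_inner_map_cutoff_le hG hΦs hY n h1 h2
  refine le_of_sq_le_sq ?_ (by positivity)
  rw [mul_pow, Real.sq_sqrt (norm_nonneg _)]
  set y := (Y G Φs E).toReal with hy
  have hy0 : 0 ≤ y := ENNReal.toReal_nonneg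
  set r := (eNorm G y A.1).toReal with hr
  -- The S-lemma needs positive energy. For `y = 0` the kernel version applies: if `G P_n x = 0`
  -- then `√G P_n x = 0`, so `P_n x`, once normalized, competes in `‖A‖_0`.
  rcases hy0.eq_or_lt with h0 | hpos
  · have h3 : (⟪(φ : H), Φ (cutoff G n) φ⟫_ℂ).re = 0 :=
      le_antisymm (hb.trans h0.symm.le) (re_inner_nonneg (hΦ.map_nonneg (hG.cutoff_nonneg n)) _)
    have h4 := hΦ.norm_map_apply_sq_le_of_ker hΦ1 hΦs (B := trunc hG n A) (r := r)
      (hG.cutoff_nonneg n) (fun x hx => ?_) h3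
    · rwa [h1, one_pow, mul_one] at h4
    · have h5 := hG.norm_sqrtOp_specProj_sq n x
      rw [hx, inner_zero_right, Complex.zero_re] at h5
      set ψ : (sqrtOp G).domain := ⟨specProj G n x, hG.specProj_mem n x⟩ with hψ
      have hψ0 : ‖(ψ : H)‖ ≤ ‖x‖ := norm_specProj_apply_le G n x
      have hψ1 : sqrtOp G ψ = 0 := norm_eq_zero.1 ((pow_eq_zero_iff two_ne_zero).1 h5)
      rw [trunc_apply, ← hψ]
      refine le_trans ?_ (mul_le_mul_of_nonneg_left hψ0 ENNReal.toReal_nonneg)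
      by_cases hz : (ψ : H) = 0
      · have : ψ = 0 := Subtype.ext hz
        rw [this, map_zero]
        simp
      · have hn : 0 < ‖(ψ : H)‖ := norm_pos_iff.2 hz
        have hc : ‖(((‖(ψ : H)‖⁻¹ : ℝ)) : ℂ)‖ = ‖(ψ : H)‖⁻¹ := by
          rw [Complex.norm_real, Real.norm_of_nonneg (by positivity)]
        have h6 := norm_le_toReal_eNorm (e := y) A
          (φ := (((‖(ψ : H)‖⁻¹ : ℝ)) : ℂ) • ψ) (by
            rw [Submodule.coe_smul, norm_smul, hc, inv_mul_cancel₀ hn.ne']) (by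
            rw [LinearPMap.map_smul, hψ1, smul_zero, norm_zero]
            simpa using hy0)
        rw [map_smul, norm_smul, hc, inv_mul_le_iff₀ hn] at h6
        linarith
  · obtain ⟨α, κ, hα, hκ, hs, hA⟩ := exists_dominating hG hG0 hpos A
    have h4 := norm_map_trunc_sq_le hG hΦ hΦ1 hα hκ hA n φ hb
    rwa [h1, one_pow, mul_one, hs] at h4

end EnergyNorm

/-! ### Uniqueness, and the theorem. -/

namespace EnergyNorm

variable {H : Type*} [NormedAddCommGroup H] [InnerProductSpace ℂ H] [CompleteSpace H]
  {G : H →ₗ.[ℂ] H} {Φ : (H →L[ℂ] H) →ₗ[ℂ] (H →L[ℂ] H)}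

theorem eNorm_sub_le (e : ℝ) (A B : InfOp G) :
    eNorm G e (A - B).1 ≤ eNorm G e A.1 + eNorm G e B.1 := by
  refine iSup_le fun φ => iSup_le fun h1 => iSup_le fun h2 => ?_
  refine (enorm_sub_le (a := A.1 φ) (b := B.1 φ)).trans (add_le_add ?_ ?_)
  · exact le_iSup_of_le φ (le_iSup_of_le h1 (le_iSup_of_le h2 le_rfl))
  · exact le_iSup_of_le φ (le_iSup_of_le h1 (le_iSup_of_le h2 le_rfl))

theorem extension_unique (hG : IsPositiveOp G) (hG0 : InfZero G) {E : ℝ} (hE : 0 < E)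
    {Ψ₁ Ψ₂ : InfOp G →ₗ[ℂ] InfOp G} (h₁ : Extends G Φ Ψ₁) (hb₁ : IsBoundedOp G E Ψ₁)
    (h₂ : Extends G Φ Ψ₂) (hb₂ : IsBoundedOp G E Ψ₂) : Ψ₁ = Ψ₂ := by
  obtain ⟨C₁, hC₁⟩ := hb₁
  obtain ⟨C₂, hC₂⟩ := hb₂
  refine LinearMap.ext fun A => sub_eq_zero.1 (eq_zero_of_eNorm_eq_zero hG hG0 hE ?_)
  refine le_antisymm (ENNReal.le_of_forall_pos_le_add fun ε hε _ => ?_) zero_le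
  obtain ⟨n, hn⟩ := exists_eNorm_sub_trunc_le hG A E (ε := ε / (C₁ + C₂ + 1)) (by positivity)
  set B := ofBounded G (trunc hG n A) with hB
  -- Both maps send the bounded operator `B` to the same image, so the difference on `A` is
  -- controlled by the `E`-norm of `A - B`.
  have e : Ψ₁ A - Ψ₂ A = Ψ₁ (A - B) - Ψ₂ (A - B) := by
    rw [map_sub, map_sub, hB, h₁, h₂, sub_sub_sub_cancel_right]
  rw [e, zero_add]
  refine (eNorm_sub_le E _ _).trans ((add_le_add (hC₁ _) (hC₂ _)).trans ?_)
  rw [← add_mul]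
  refine (mul_le_mul_right hn _).trans ?_
  have h : ENNReal.ofReal (ε / (C₁ + C₂ + 1)) = ((ε / (C₁ + C₂ + 1) : NNReal) : ENNReal) := by
    rw [← ENNReal.ofReal_coe_nnreal]
    rfl
  rw [h]
  norm_cast
  rw [mul_div_assoc', div_le_iff₀ (by positivity), mul_comm]
  exact mul_le_mul' le_rfl le_self_add

end EnergyNorm

theorem proposition8 {H : Type*} [NormedAddCommGroup H] [InnerProductSpace ℂ H]
    [CompleteSpace H] [TopologicalSpace.SeparableSpace H]
    (G : H →ₗ.[ℂ] H) (hG : EnergyNorm.IsPositiveOp G) (hG0 : EnergyNorm.InfZero G)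
    (E : ℝ) (hE : 0 < E)
    (Φ : (H →L[ℂ] H) →ₗ[ℂ] (H →L[ℂ] H)) (hΦ : EnergyNorm.IsTwoPositive Φ) (hΦ1 : Φ 1 ≤ 1)
    (Φs : EnergyNorm.TraceClass H → EnergyNorm.TraceClass H)
    (hΦs : EnergyNorm.IsPredual Φ Φs)
    (hY : EnergyNorm.Y G Φs E < ⊤) :
    ∃ ΦG : EnergyNorm.InfOp G →ₗ[ℂ] EnergyNorm.InfOp G,
      EnergyNorm.Extends G Φ ΦG ∧ EnergyNorm.IsBoundedOp G E ΦG ∧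
      (∀ Ψ : EnergyNorm.InfOp G →ₗ[ℂ] EnergyNorm.InfOp G,
        EnergyNorm.Extends G Φ Ψ → EnergyNorm.IsBoundedOp G E Ψ → Ψ = ΦG) ∧
      ∀ A : EnergyNorm.InfOp G,
        EnergyNorm.eNorm G E (ΦG A) ≤
          ENNReal.ofReal (√‖Φ 1‖) * EnergyNorm.eNorm G (EnergyNorm.Y G Φs E).toReal A ∧
        ENNReal.ofReal (√‖Φ 1‖) * EnergyNorm.eNorm G (EnergyNorm.Y G Φs E).toReal A ≤
          ENNReal.ofReal (√(‖Φ 1‖ * max 1 ((EnergyNorm.Y G Φs E).toReal / E))) *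
            EnergyNorm.eNorm G E A := by
  set y := (EnergyNorm.Y G Φs E).toReal with hy
  obtain ⟨ΦG, hlim⟩ := EnergyNorm.exists_extension hG hG0 hΦ hΦ1 hΦs hE hY
  have hfirst : ∀ A : EnergyNorm.InfOp G, EnergyNorm.eNorm G E (ΦG A).1 ≤
      ENNReal.ofReal (√‖Φ 1‖) * EnergyNorm.eNorm G y A.1 := fun A => by
    rw [← ENNReal.ofReal_toReal (EnergyNorm.eNorm_lt_top y A).ne,
      ← ENNReal.ofReal_mul (Real.sqrt_nonneg _)]
    refine EnergyNorm.eNorm_le_ofReal fun φ h1 h2 => ?_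
    exact le_of_tendsto (hlim A φ).norm (Filter.Eventually.of_forall fun n =>
      EnergyNorm.norm_extension_apply_le hG hG0 hΦ hΦ1 hΦs hY n A h1 h2)
  have hsecond : ∀ A : EnergyNorm.InfOp G,
      ENNReal.ofReal (√‖Φ 1‖) * EnergyNorm.eNorm G y A.1 ≤
        ENNReal.ofReal (√(‖Φ 1‖ * max 1 (y / E))) * EnergyNorm.eNorm G E A.1 := fun A => by
    rw [Real.sqrt_mul (norm_nonneg _), ENNReal.ofReal_mul (Real.sqrt_nonneg _), mul_assoc]
    gcongr
    exact EnergyNorm.eNorm_le_mul_eNorm hG hG0 hE A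
  have hext : EnergyNorm.Extends G Φ ΦG := fun B => by
    refine Subtype.ext (LinearMap.ext fun φ => ?_)
    refine tendsto_nhds_unique (hlim (EnergyNorm.ofBounded G B) φ) ?_
    -- The truncations of the restriction of `B` are, by definition, the products `B P_n`.
    exact EnergyNorm.tendsto_map_mul_specProj hG hΦ hΦ1 hΦs B φ
  have hbdd : EnergyNorm.IsBoundedOp G E ΦG :=
    ⟨(√(‖Φ 1‖ * max 1 (y / E))).toNNReal, fun A => (hfirst A).trans (hsecond A)⟩
  refine ⟨ΦG, hext, hbdd, fun Ψ hΨ hΨb => ?_, fun A => ⟨hfirst A, hsecond A⟩⟩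
  exact EnergyNorm.extension_unique hG hG0 hE hΨ hΨb hext hbdd
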